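/- Let $p$ be a prime number and let $R$ be a $p$-torsion-free $p$-Zariskian (i.e. $p$ lies in the Jacobson radical of $R$) $\delta$-ring with Frobenius lift $\varphi(a)=a^p+p\,\delta(a)$, such that $R/pR$ is reduced. For $i\ge 0$ let $R^{1/p^i}$ be the colimit of $R\xrightarrow{\varphi}R\xrightarrow{\varphi}\cdots\xrightarrow{\varphi}R$ ($i+1$ terms), regarded as an $R$-algebra through the first term, and let $R_{\mathrm{perf}}=\operatorname{colim}_{\varphi}R$. Fix in $\overline{\mathbb Q}$ compatible sequences $\{p^{1/p^i}\}_{i\ge 0}$ of $p$-power roots of $p$ and $\{\zeta_{p^i}\}_{i\ge 0}$ of primitive $p^i$-th roots of unity, and write $\zeta_p^{1/p^i}=\zeta_{p^{i+1}}$. *Terminology.* A tower of rings $R_0\to R_1\to\cdots$ with transition maps $\iota_i$ is a *perfectoid tower arising from* $(S,I_0)$, where $I_0$ is an ideal of the ring $S$, if: (a) $R_0\cong S$ and $p\in I_0$; (b) the induced maps $\overline{\iota_i}\colon R_i/I_0R_i\to R_{i+1}/I_0R_{i+1}$ are injective; (c) the image of the Frobenius map of $R_{i+1}/I_0R_{i+1}$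 is contained in the image of $\overline{\iota_i}$, so that the Frobenius map is $\overline{\iota_i}\circ F_i$ for a unique ring map $F_i\colon R_{i+1}/I_0R_{i+1}\to R_i/I_0R_i$; (d) each $F_i$ is surjective; (e) each $I_0R_i$ is contained in the Jacobson radical of $R_i$; (f) $I_0$ is principal and there is a principal ideal $I_1\subseteq R_1$ such that $I_1^{[p]}=I_0R_1$ and, for every $i\ge 0$, $\ker F_i$ is generated by the image of $I_1$ in $R_{i+1}/I_0R_{i+1}$; (g) $R_i[I_0^\infty]=R_i[I_0]$ for every $i$, and there are bijections of sets $R_{i+1}[I_0^\infty]\to R_i[I_0^\infty]$ compatible with $F_i$. Its *tilt* is the tower with terms $R_i^{s.\flat}=\varprojlim\{\cdots\xrightarrow{F_{i+1}}R_{i+1}/I_0R_{i+1}\xrightarrow{F_i}R_i/I_0R_i\}$ and with the transition maps induced by the $\overline{\iota_j}$. Then the following hold. 1. The towers $$R\to R^{1/p}\otimes_{\mathbb Z}\mathbb Z[p^{1/p}]\to\cdots\to R^{1/p^i}\otimes_{\mathbb Z}\mathbb Z[p^{1/p^i}]\to\cdots\qquad(1)$$ $$R\otimes_{\mathbb Z}\mathbb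 Z[\zeta_p]\to R^{1/p}\otimes_{\mathbb Z}\mathbb Z[\zeta_p^{1/p}]\to\cdots\to R^{1/p^i}\otimes_{\mathbb Z}\mathbb Z[\zeta_p^{1/p^i}]\to\cdots\qquad(2)$$ are perfectoid towers with $p$-torsion-free terms, arising from $(R,(p))$ and $(R\otimes_{\mathbb Z}\mathbb Z[\zeta_p],(p))$ respectively. 2. If $R$ is $p$-adically separated, the transition maps of (1) and (2) are injective. 3. The $p$-adic completions of the colimits of (1) and (2) are isomorphic, as rings, to the $p$-adic completions $(R_{\mathrm{perf}}\otimes_{\mathbb Z}\mathbb Z[p^{1/p^\infty}])^{\wedge_p}$ and $(R_{\mathrm{perf}}\otimes_{\mathbb Z}\mathbb Z[\zeta_{p^\infty}])^{\wedge_p}$ respectively. The second is also isomorphic to $(R_{\mathrm{perf}}\otimes_{\mathbb Z}\mathbb Z_p[\zeta_{p^\infty}])^{\wedge_p}$ and, for every $\mathbb Z_p$-algebra structure on $R_{\mathrm{perf}}$ (if there is one), to $(R_{\mathrm{perf}}\otimes_{\mathbb Z_p}\mathbb Z_p[\zeta_{p^\infty}])^{\wedge_p}$. 4. The tilts of (1)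 and (2) are both isomorphic to the tower $(R/pR)[[T]]\xrightarrow{F}(R/pR)[[T]]\xrightarrow{F}\cdots$, where $F$ is the Frobenius map. 5. Assume further that $R$ is $p$-adically separated, that $R$ and $R/pR$ are integral domains, and that $\varphi$ is finite. Let $R^+$ be an absolute integral closure of $R$, i.e. the integral closure of $R$ in an algebraic closure of its fraction field. Then there are compatible embeddings over $R$ of the rings $R^{1/p^i}$ into $R^+$, and $R^+$ contains compatible sequences $\{p^{1/p^i}\}$ and $\{\zeta_{p^i}\}$ as above. For any choice of these, the canonical maps are isomorphisms from the towers (1) and (2) onto the towers of subrings of $R^+$ $$R\hookrightarrow R^{1/p}[p^{1/p}]\hookrightarrow\cdots\hookrightarrow R^{1/p^i}[p^{1/p^i}]\hookrightarrow\cdots,$$ $$R[\zeta_p]\hookrightarrow R^{1/p}[\zeta_{p^2}]\hookrightarrow\cdots\hookrightarrow R^{1/p^i}[\zeta_{p^{i+1}}]\hookrightarrow\cdots.$$ -/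

import Mathlib

open scoped TensorProduct

universe u v

noncomputable section

/-! ### Delta-rings -/

/-- A `δ`-structure on a commutative ring `R` with respect to `p`.  The integer
`p.choose k / p` is an exact quotient for `0 < k < p`, so the sum below is
`((a + b) ^ p - a ^ p - b ^ p) / p` evaluated as a polynomial with integer coefficients. -/
structure DeltaStructure (p : ℕ) (R : Type u) [CommRing R] where
  /-- The operation `δ`. -/
  delta : R → R
  delta_zero : delta 0 = 0
  delta_one : delta 1 = 0
  delta_add : ∀ a b, delta (a + b) = delta a + delta b -
    ∑ k ∈ Finset.Ioo 0 p, a ^ k * b ^ (p - k) * ((p.choose k / p : ℕ) : R)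
  delta_mul : ∀ a b, delta (a * b) =
    a ^ p * delta b + b ^ p * delta a + (p : R) * delta a * delta b

namespace DeltaStructure

variable {p : ℕ} [hp : Fact p.Prime] {R : Type u} [CommRing R] (D : DeltaStructure p R)

/-- The Frobenius lift `φ(a) = a ^ p + p δ(a)` of a `δ`-ring. -/
def frob : R →+* R where
  toFun a := a ^ p + (p : R) * D.delta a
  map_zero' := by simp [D.delta_zero, hp.out.ne_zero]
  map_one' := by simp [D.delta_one]
  map_add' a b := by
    rw [D.delta_add, add_pow_prime_eq' hp.out]
    ring
  map_mul' a b := by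
    rw [D.delta_mul]
    ring

/-- `R^{1/p^i}`: the colimit of `R → R → ⋯ → R` (`i + 1` copies of `R`, all maps being `φ`). -/
abbrev Root (i : ℕ) : Type u :=
  Ring.DirectLimit (fun _ : Fin (i + 1) => R)
    (fun j k _ => ⇑(D.frob ^ ((k : ℕ) - (j : ℕ)) : R →+* R))

/-- The canonical map `c_j^i : R → R^{1/p^i}` from the `j`-th term of the colimit. -/
def toRoot (i : ℕ) (j : Fin (i + 1)) : R →+* D.Root i :=
  Ring.DirectLimit.of (fun _ : Fin (i + 1) => R)
    (fun j k _ => ⇑(D.frob ^ ((k : ℕ) - (j : ℕ)) : R →+* R)) j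

/-- The transition map `t_i : R^{1/p^i} → R^{1/p^{i+1}}` induced by `c_0^{i+1}, …, c_i^{i+1}`. -/
def rootMap (i : ℕ) : D.Root i →+* D.Root (i + 1) :=
  Ring.DirectLimit.lift _ _ _ (fun j => D.toRoot (i + 1) j.castSucc) (fun j k hjk x =>
    Ring.DirectLimit.of_f (G := fun _ : Fin (i + 1 + 1) => R)
      (f := fun j k _ => ⇑(D.frob ^ ((k : ℕ) - (j : ℕ)) : R →+* R))
      (i := j.castSucc) (j := k.castSucc) hjk x)

/-- `R_perf`: the colimit of `R → R → R → ⋯` along `φ`. -/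
abbrev Perf : Type u :=
  Ring.DirectLimit (fun _ : ℕ => R) (fun j k _ => ⇑(D.frob ^ (k - j) : R →+* R))

end DeltaStructure

/-- `R` is `p`-torsion-free. -/
def IsPTorsionFree (p : ℕ) (R : Type u) [CommRing R] : Prop :=
  ∀ x : R, (p : R) * x = 0 → x = 0

/-- `R` is `I`-Zariskian: the ideal `I` is contained in the Jacobson radical of `R`. -/
def IsZariskian {R : Type u} [CommRing R] (I : Ideal R) : Prop :=
  I ≤ Ideal.jacobson ⊥

/-- The `p`-adic completion of `R`. -/
abbrev PCompletion (p : ℕ) (R : Type u) [CommRing R] : Type u :=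
  AdicCompletion (Ideal.span {(p : R)}) R

/-! ### Towers of rings -/

/-- A tower of commutative rings `A_0 → A_1 → A_2 → ⋯`. -/
structure RingTower where
  /-- The terms of the tower. -/
  obj : ℕ → Type u
  [commRing : ∀ i, CommRing (obj i)]
  /-- The transition maps of the tower. -/
  map : ∀ i, obj i →+* obj (i + 1)

attribute [instance] RingTower.commRing

/-- An isomorphism of towers of rings. -/
structure TowerIso (A : RingTower.{u}) (B : RingTower.{v}) where
  /-- The isomorphism in each degree. -/
  equiv : ∀ i, A.obj i ≃+* B.obj i
  comm : ∀ i (x : A.obj i), equiv (i + 1) (A.map i x) = B.map i (equiv i x)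

namespace RingTower

variable (T : RingTower.{u})

/-- The composite transition map `A_i → A_j` for `i ≤ j`. -/
def trans (i j : ℕ) (h : i ≤ j) : T.obj i →+* T.obj j :=
  Nat.leRec (motive := fun j _ => T.obj i →+* T.obj j) (RingHom.id _)
    (fun k _ f => (T.map k).comp f) h

/-- The colimit of a tower. -/
abbrev Colim : Type u :=
  Ring.DirectLimit T.obj (fun i j h => ⇑(T.trans i j h))

theorem trans_succ {i j : ℕ} (h : i ≤ j) :
    T.trans i (j + 1) (Nat.le_succ_of_le h) = (T.map j).comp (T.trans i j h) :=
  Nat.leRec_succ (motive := fun j _ => T.obj i →+* T.obj j) (RingHom.id _)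
    (fun k _ f => (T.map k).comp f) h

variable {R : Type v} [CommRing R]

/-- The ideal `I_0 R_i` of `R_i`, where `R ≅ R_0`. -/
def extIdeal (e : R ≃+* T.obj 0) (I0 : Ideal R) (i : ℕ) : Ideal (T.obj i) :=
  I0.map ((T.trans 0 i (Nat.zero_le i)).comp (e : R →+* T.obj 0))

/-- The quotient ring `R_i / I_0 R_i`. -/
abbrev Red (e : R ≃+* T.obj 0) (I0 : Ideal R) (i : ℕ) : Type u :=
  T.obj i ⧸ T.extIdeal e I0 i

theorem extIdeal_le_comap (e : R ≃+* T.obj 0) (I0 : Ideal R) (i : ℕ) :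
    T.extIdeal e I0 i ≤ (T.extIdeal e I0 (i + 1)).comap (T.map i) := by
  rw [← Ideal.map_le_iff_le_comap, extIdeal, extIdeal, Ideal.map_map, ← RingHom.comp_assoc,
    ← T.trans_succ (Nat.zero_le i)]

/-- The map `R_i / I_0 R_i → R_{i+1} / I_0 R_{i+1}` induced by the transition map. -/
def redMap (e : R ≃+* T.obj 0) (I0 : Ideal R) (i : ℕ) :
    T.Red e I0 i →+* T.Red e I0 (i + 1) :=
  Ideal.quotientMap _ (T.map i) (T.extIdeal_le_comap e I0 i)

/-- The `I`-power-torsion part of a ring. -/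
def powTorsion {A : Type u} [CommRing A] (I : Ideal A) : Set A :=
  {x | ∃ n : ℕ, ∀ a ∈ I ^ n, a * x = 0}

/-- The `I`-torsion part of a ring. -/
def torsion {A : Type u} [CommRing A] (I : Ideal A) : Set A :=
  {x | ∀ a ∈ I, a * x = 0}

end RingTower

/-- The Frobenius map `x ↦ x ^ p` of a ring in which `p = 0` (the zero ring is allowed). -/
def frobeniusOf (p : ℕ) [hp : Fact p.Prime] (A : Type u) [CommRing A] (h : (p : A) = 0) :
    A →+* A where
  toFun x := x ^ p
  map_zero' := zero_pow hp.out.ne_zero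
  map_one' := one_pow p
  map_add' a b := by rw [add_pow_prime_eq' hp.out, h, zero_mul, add_zero]
  map_mul' a b := mul_pow a b p

/-- The perfect tower `A → A → A → ⋯` whose transition maps are the Frobenius map. -/
def frobeniusTower (p : ℕ) [Fact p.Prime] (A : Type u) [CommRing A] (h : (p : A) = 0) :
    RingTower.{u} where
  obj _ := A
  map _ := frobeniusOf p A h

/-! ### Perfectoid towers -/

open RingTower

/-- `T` is a `p`-purely inseparable tower arising from `(R, I0)`, with `e` identifying `R` with
the zeroth term of the tower. -/
structure IsPurelyInseparableTower (p : ℕ) {R : Type v} [CommRing R] (T : RingTower.{u})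
    (e : R ≃+* T.obj 0) (I0 : Ideal R) : Prop where
  p_mem : (p : R) ∈ I0
  injective : ∀ i, Function.Injective (T.redMap e I0 i)
  frobenius_mem : ∀ i (x : T.Red e I0 (i + 1)), x ^ p ∈ (T.redMap e I0 i).range

namespace IsPurelyInseparableTower

theorem p_eq_zero {p : ℕ} {R : Type v} [CommRing R] {T : RingTower.{u}}
    {e : R ≃+* T.obj 0} {I0 : Ideal R} (h : IsPurelyInseparableTower p T e I0) (i : ℕ) : ((p : ℕ) : T.Red e I0 i) = 0 := by
  have h1 := Ideal.mem_map_of_mem ((T.trans 0 i (Nat.zero_le i)).comp (e : R →+* T.obj 0)) h.p_mem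
  rw [map_natCast] at h1
  have h2 := Ideal.Quotient.eq_zero_iff_mem.mpr h1
  rwa [map_natCast] at h2

variable {p : ℕ} [hp : Fact p.Prime] {R : Type v} [CommRing R] {T : RingTower.{u}}
  {e : R ≃+* T.obj 0} {I0 : Ideal R} (h : IsPurelyInseparableTower p T e I0)

/-- The `i`-th Frobenius projection `F_i : R_{i+1}/I_0R_{i+1} → R_i/I_0R_i`: the unique map whose
composition with the (injective) map `R_i/I_0R_i → R_{i+1}/I_0R_{i+1}` is the Frobenius map. -/
def frobProj (i : ℕ) : T.Red e I0 (i + 1) →+* T.Red e I0 i :=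
  ((RingEquiv.ofBijective (T.redMap e I0 i).rangeRestrict
      ⟨fun _ _ hab => h.injective i (congrArg Subtype.val hab),
        (T.redMap e I0 i).rangeRestrict_surjective⟩).symm : _ →+* _).comp
    ((frobeniusOf p (T.Red e I0 (i + 1)) (h.p_eq_zero (i + 1))).codRestrict
      (T.redMap e I0 i).range (h.frobenius_mem i))

theorem redMap_frobProj (i : ℕ) (x : T.Red e I0 (i + 1)) :
    T.redMap e I0 i (h.frobProj i x) = x ^ p :=
  congrArg Subtype.val ((RingEquiv.ofBijective (T.redMap e I0 i).rangeRestrict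
      ⟨fun _ _ hab => h.injective i (congrArg Subtype.val hab),
        (T.redMap e I0 i).rangeRestrict_surjective⟩).apply_symm_apply
    ((frobeniusOf p (T.Red e I0 (i + 1)) (h.p_eq_zero (i + 1))).codRestrict
      (T.redMap e I0 i).range (h.frobenius_mem i) x))

theorem frobProj_redMap (i : ℕ) (x : T.Red e I0 i) :
    h.frobProj i (T.redMap e I0 i x) = x ^ p :=
  h.injective i (by rw [redMap_frobProj, map_pow])

/-- The `i`-th small tilt: the inverse limit of
`⋯ → R_{i+2}/I_0R_{i+2} → R_{i+1}/I_0R_{i+1} → R_i/I_0R_i` along the Frobenius projections. -/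
def smallTilt (i : ℕ) : Subring (∀ j : {j : ℕ // i ≤ j}, T.Red e I0 j) where
  carrier := {x | ∀ (j : ℕ) (hj : i ≤ j),
    h.frobProj j (x ⟨j + 1, Nat.le_succ_of_le hj⟩) = x ⟨j, hj⟩}
  mul_mem' ha hb j hj := by rw [Pi.mul_apply, map_mul, ha j hj, hb j hj]; rfl
  one_mem' j hj := by rw [Pi.one_apply, map_one]; rfl
  add_mem' ha hb j hj := by rw [Pi.add_apply, map_add, ha j hj, hb j hj]; rfl
  zero_mem' j hj := by rw [Pi.zero_apply, map_zero]; rfl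
  neg_mem' ha j hj := by rw [Pi.neg_apply, map_neg, ha j hj]; rfl

/-- The map on sequences sending `(x_j)_{j ≥ i}` to the sequence whose term in degree `j + 1 ≥ i + 1`
is the image of `x_j` in `R_{j+1}/I_0R_{j+1}`. -/
def shiftMap (T : RingTower.{u}) (e : R ≃+* T.obj 0) (I0 : Ideal R) (i : ℕ) :
    (∀ j : {j : ℕ // i ≤ j}, T.Red e I0 j) →+* (∀ j : {j : ℕ // i + 1 ≤ j}, T.Red e I0 j) :=
  RingHom.pi fun j => match j with
    | ⟨0, hj⟩ => absurd hj (Nat.not_succ_le_zero i)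
    | ⟨j + 1, hj⟩ => (T.redMap e I0 j).comp
        (Pi.evalRingHom (fun j : {j : ℕ // i ≤ j} => T.Red e I0 j) ⟨j, Nat.le_of_succ_le_succ hj⟩)

theorem shiftMap_mem (i : ℕ) (x : h.smallTilt i) :
    shiftMap T e I0 i x.1 ∈ h.smallTilt (i + 1) := by
  intro j hj
  cases j with
  | zero => exact absurd hj (Nat.not_succ_le_zero i)
  | succ j =>
    have hx := x.2 j (Nat.le_of_succ_le_succ hj)
    change h.frobProj (j + 1) (T.redMap e I0 (j + 1) (x.1 ⟨j + 1, _⟩)) =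
      T.redMap e I0 j (x.1 ⟨j, _⟩)
    rw [frobProj_redMap, ← hx, redMap_frobProj]

/-- The tilt of a tower: its terms are the small tilts, its transition maps are the inverse limits
of the maps `R_j/I_0R_j → R_{j+1}/I_0R_{j+1}`. -/
def tilt : RingTower.{u} where
  obj i := h.smallTilt i
  map i := ((shiftMap T e I0 i).comp (h.smallTilt i).subtype).codRestrict
    (h.smallTilt (i + 1)) (h.shiftMap_mem i)

end IsPurelyInseparableTower

/-- `T` is a perfectoid tower arising from `(R, I0)`, with `e` identifying `R` with the zeroth term
of the tower. -/
structure IsPerfectoidTower (p : ℕ) [Fact p.Prime] {R : Type v} [CommRing R] (T : RingTower.{u})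
    (e : R ≃+* T.obj 0) (I0 : Ideal R) : Prop extends IsPurelyInseparableTower p T e I0 where
  surjective : ∀ i, Function.Surjective (toIsPurelyInseparableTower.frobProj i)
  zariskian : ∀ i, IsZariskian (T.extIdeal e I0 i)
  principal : I0.IsPrincipal
  pillar : ∃ I1 : Ideal (T.obj 1), I1.IsPrincipal ∧
    Ideal.span {y | ∃ x ∈ I1, y = x ^ p} = T.extIdeal e I0 1 ∧
    ∀ i, RingHom.ker (toIsPurelyInseparableTower.frobProj i) =
      I1.map ((Ideal.Quotient.mk (T.extIdeal e I0 (i + 1))).comp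
        (T.trans 1 (i + 1) (Nat.le_add_left 1 i)))
  torsion_eq : ∀ i, powTorsion (T.extIdeal e I0 i) = torsion (T.extIdeal e I0 i)
  torsion_bij : ∀ i, ∃ F : powTorsion (T.extIdeal e I0 (i + 1)) → powTorsion (T.extIdeal e I0 i),
    Function.Bijective F ∧ ∀ x, Ideal.Quotient.mk (T.extIdeal e I0 i) (F x).1 =
      toIsPurelyInseparableTower.frobProj i (Ideal.Quotient.mk (T.extIdeal e I0 (i + 1)) x.1)

/-! ### Adjoining roots -/

/-- `x 0 = a` and `x (i + 1) ^ p = x i`: a compatible sequence `x i = a^{1/p^i}`. -/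
def IsCompatibleRoots (p : ℕ) {A : Type u} [CommRing A] (a : A) (x : ℕ → A) : Prop :=
  x 0 = a ∧ ∀ i, x (i + 1) ^ p = x i

/-- `z i = ζ_{p^i}`: a compatible sequence of primitive `p^i`-th roots of unity. -/
def IsCompatibleRootsOfUnity (p : ℕ) {A : Type u} [CommRing A] (z : ℕ → A) : Prop :=
  (∀ i, IsPrimitiveRoot (z i) (p ^ i)) ∧ ∀ i, z (i + 1) ^ p = z i

/-- An algebraic closure of the rationals. -/
abbrev QBar : Type := AlgebraicClosure ℚ

/-- The subring `ℤ[a]` of `QBar`. -/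
abbrev ZAdjoin (a : QBar) : Subalgebra ℤ QBar := Algebra.adjoin ℤ {a}

/-- The subring `ℤ[x 0, x 1, x 2, …]` of `QBar`. -/
abbrev ZAdjoinAll (x : ℕ → QBar) : Subalgebra ℤ QBar := Algebra.adjoin ℤ (Set.range x)

/-- The subring `ℤ_p[ζ_{p^∞}]` of an algebraic closure of `ℚ_p`. -/
abbrev ZpCyc (p : ℕ) [Fact p.Prime] : Subalgebra ℤ_[p] (AlgebraicClosure ℚ_[p]) :=
  Algebra.adjoin ℤ_[p] {z | ∃ n : ℕ, z ^ p ^ n = 1}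

theorem ZAdjoin_le {p : ℕ} {x : ℕ → QBar} (hx : ∀ i, x (i + 1) ^ p = x i) (i : ℕ) :
    ZAdjoin (x i) ≤ ZAdjoin (x (i + 1)) := by
  refine Algebra.adjoin_le (Set.singleton_subset_iff.mpr ?_)
  rw [SetLike.mem_coe, ← hx i]
  exact pow_mem (Algebra.subset_adjoin (Set.mem_singleton _)) p

/-- For a sequence with `x (i + 1) ^ p = x i`, the tower
`⋯ → R^{1/p^i} ⊗ ℤ[x i] → R^{1/p^{i+1}} ⊗ ℤ[x (i + 1)] → ⋯`. -/
def adjoinTower {p : ℕ} [Fact p.Prime] {R : Type u} [CommRing R] (D : DeltaStructure p R)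
    (x : ℕ → QBar) (hx : ∀ i, x (i + 1) ^ p = x i) : RingTower.{u} where
  obj i := D.Root i ⊗[ℤ] ZAdjoin (x i)
  map i := (Algebra.TensorProduct.map (D.rootMap i).toIntAlgHom
    (Subalgebra.inclusion (ZAdjoin_le hx i)) : _ →ₐ[ℤ] _).toRingHom

/-- The tower `R → R^{1/p} ⊗ ℤ[p^{1/p}] → ⋯ → R^{1/p^i} ⊗ ℤ[p^{1/p^i}] → ⋯`. -/
abbrev pRootTower {p : ℕ} [Fact p.Prime] {R : Type u} [CommRing R] (D : DeltaStructure p R)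
    {π : ℕ → QBar} (hπ : IsCompatibleRoots p (p : QBar) π) : RingTower.{u} :=
  adjoinTower D π hπ.2

/-- The tower `R ⊗ ℤ[ζ_p] → R^{1/p} ⊗ ℤ[ζ_p^{1/p}] → ⋯ → R^{1/p^i} ⊗ ℤ[ζ_p^{1/p^i}] → ⋯`, where
`ζ_p^{1/p^i} = ζ_{p^{i+1}}`. -/
abbrev cyclotomicTower {p : ℕ} [Fact p.Prime] {R : Type u} [CommRing R] (D : DeltaStructure p R)
    {ζ : ℕ → QBar} (hζ : IsCompatibleRootsOfUnity p ζ) : RingTower.{u} :=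
  adjoinTower D (fun i => ζ (i + 1)) (fun i => hζ.2 (i + 1))

/-- A compatible system of embeddings over `R` of the rings `R^{1/p^i}` into an `R`-algebra. -/
structure IsCompatibleEmbedding {p : ℕ} [Fact p.Prime] {R : Type u} [CommRing R]
    (D : DeltaStructure p R) {B : Type v} [CommRing B] [Algebra R B]
    (ε : ∀ i, D.Root i →+* B) : Prop where
  injective : ∀ i, Function.Injective (ε i)
  commutes : ∀ i (r : R), ε i (D.toRoot i 0 r) = algebraMap R B r
  comm : ∀ i (r : D.Root i), ε (i + 1) (D.rootMap i r) = ε i r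

/-- The subring `R^{1/p^i}[y i]` of `B`. -/
def subringAdjoin {p : ℕ} [Fact p.Prime] {R : Type u} [CommRing R]
    (D : DeltaStructure p R) {B : Type v} [CommRing B]
    (ε : ∀ i, D.Root i →+* B) (y : ℕ → B) (i : ℕ) : Subring B :=
  Subring.closure (Set.range (ε i) ∪ {y i})

/-- The tower of an increasing sequence of subrings, with the inclusions as transition maps. -/
def subringTower {B : Type v} [CommRing B] (S : ℕ → Subring B) (hS : Monotone S) :
    RingTower.{v} where
  obj i := S i
  map i := Subring.inclusion (hS (Nat.le_succ i))

/-- The tower `R^{1/p^i} ⊗ ℤ[x i]` is isomorphic to the tower of subrings `R^{1/p^i}[y i]` of `B`,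
via `r ⊗ 1 ↦ r` and `1 ⊗ x i ↦ y i`. -/
def IsSubringTower {p : ℕ} [Fact p.Prime] {R : Type u} [CommRing R] (D : DeltaStructure p R)
    (x : ℕ → QBar) (hx : ∀ i, x (i + 1) ^ p = x i) {B : Type v} [CommRing B]
    (ε : ∀ i, D.Root i →+* B) (y : ℕ → B) : Prop :=
  ∃ (hS : Monotone (subringAdjoin D ε y))
    (E : TowerIso (adjoinTower D x hx) (subringTower (subringAdjoin D ε y) hS)), ∀ i,
      (∀ r : D.Root i, Subtype.val
        (E.equiv i (r ⊗ₜ[ℤ] (1 : ZAdjoin (x i)) : D.Root i ⊗[ℤ] ZAdjoin (x i))) = ε i r) ∧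
      Subtype.val (E.equiv i ((1 : D.Root i) ⊗ₜ[ℤ]
        (⟨x i, Algebra.self_mem_adjoin_singleton ℤ (x i)⟩ : ZAdjoin (x i)) :
          D.Root i ⊗[ℤ] ZAdjoin (x i))) = y i

theorem natCast_quotient_eq_zero (p : ℕ) (R : Type u) [CommRing R] :
    ((p : ℕ) : PowerSeries (R ⧸ Ideal.span {(p : R)})) = 0 := by
  have h : ((p : ℕ) : R ⧸ Ideal.span {(p : R)}) = 0 := by
    rw [← map_natCast (Ideal.Quotient.mk (Ideal.span {(p : R)})), Ideal.Quotient.eq_zero_iff_mem]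
    exact Ideal.mem_span_singleton_self _
  rw [← map_natCast (PowerSeries.C (R := R ⧸ Ideal.span {(p : R)})), h, map_zero]

/-- The tower `(R/pR)⟦T⟧ → (R/pR)⟦T⟧ → ⋯` whose transition maps are the Frobenius map. -/
abbrev powerSeriesTower (p : ℕ) [Fact p.Prime] (R : Type u) [CommRing R] : RingTower.{u} :=
  frobeniusTower p (PowerSeries (R ⧸ Ideal.span {(p : R)})) (natCast_quotient_eq_zero p R)

end

universe w

/-! ### Towers with truncated polynomial reductions: perfectoid axioms and tilt -/

noncomputable section

open Polynomial RingTower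

/-! Identify R^{1/p^i} with R through the last term of its colimit, so that all transition maps
R^{1/p^i} → R^{1/p^{i+1}} become φ. Put y_i = x_i - c, where x_i = p^{1/p^i}, c = 0 for the first
tower and x_i = ζ_{p^{i+1}}, c = 1 for the second. Then y_i is a root of a monic g_i = X^{n_i} + p
h_i of degree n_i = p^i n_0 with h_i(0) = ±1, namely X^{p^i} - p (n_0 = 1) or Φ_{p^{i+1}}(X + 1)
(n_0 = p - 1). As ℤ[x_i] = ℤ[X]/(g_i), the i-th term is R[X]/(g_i), and modulo p it is
k[X]/(X^{n_i}) with k = R/pR.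

Modulo p, φ is the Frobenius and y_i ≡ y_{i+1}^p, so the transition map k[X]/(X^{n_i}) → k[X]/(X^{p
n_i}) is f ↦ f^p. It is injective because k is reduced. Hence F_i is the truncation map, surjective
with kernel (X^{n_i}), and the limit along the F_i is k⟦X⟧ with Frobenius as transition map.
`TruncatedPresentation` records exactly this input. The ideal I_1 is generated by y_1^{n_0}: one has
y_1^{n_1} = -p h_1(y_1), and h_1(y_1) is a unit because y_1 lies in the Jacobson radical.

Over a p-adically separated R, φ is injective, and flatness over ℤ carries this to the tensor
products. The colimits agree with R_perf ⊗ ℤ[x_0, x_1, …] before completion; only the passage to ℤ_p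
needs completion, and there ℤ[ζ_{p^∞}] → ℤ_p[ζ_{p^∞}] is an isomorphism modulo every p^k.

For the subrings of R^+ the point is that g_i generates the kernel of evaluation R[X] → R^+,
although R need not be integrally closed. `IsUniformizerPoly.eval₂_eq_zero_iff` proves this by an
Eisenstein argument that uses only that p is prime in R and R is p-adically separated. The same
argument over ℤ presents ℤ[x_i], and over ℤ_p it gives the comparison of cyclotomic rings. -/

/-- A presentation of the reductions `R_i / I_0 R_i` of a tower as truncated polynomial rings
`k[X] / (X ^ n_i)`, for which the transition maps are lifts of the Frobenius map of `k[X]`. -/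
structure TruncatedPresentation (p : ℕ) (k : Type u) [CommRing k] {S : Type v} [CommRing S]
    (T : RingTower.{u}) (e : S ≃+* T.obj 0) (I0 : Ideal S) where
  /-- The exponents. -/
  n : ℕ → ℕ
  n_zero_pos : 0 < n 0
  n_succ : ∀ i, n (i + 1) = p * n i
  /-- The presentations. -/
  s : ∀ i, k[X] →+* T.Red e I0 i
  surj : ∀ i, Function.Surjective (s i)
  ker : ∀ i f, s i f = 0 ↔ X ^ n i ∣ f
  redMap_s : ∀ i f, T.redMap e I0 i (s i f) = s (i + 1) f ^ p

/-- If a is the lowest nonzero coefficient of f, in degree d < n, then f^p has coefficient a^p in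
degree p d, which is nonzero since k is reduced. This is the injectivity of the transition maps
modulo p. -/
theorem Polynomial.X_pow_mul_dvd_pow_iff {k : Type u} [CommRing k] [IsReduced k] {p n : ℕ}
    (hp : p ≠ 0) {f : k[X]} : X ^ (p * n) ∣ f ^ p ↔ X ^ n ∣ f := by
  refine ⟨fun h => ?_, fun h => by rw [mul_comm, pow_mul]; exact pow_dvd_pow_of_dvd h p⟩
  rw [X_pow_dvd_iff]
  by_contra! H
  classical
  obtain ⟨hd, hne⟩ := Nat.find_spec H
  obtain ⟨d, hd'⟩ : ∃ d, d = Nat.find H := ⟨_, rfl⟩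
  rw [← hd'] at hd hne
  have h1 : X ^ d ∣ f := X_pow_dvd_iff.2 fun e he => by
    by_contra h0
    exact Nat.find_min H (hd' ▸ he) ⟨he.trans hd, h0⟩
  obtain ⟨g, rfl⟩ := h1
  rw [X_pow_dvd_iff] at h
  have h2 := h (p * d) (Nat.mul_lt_mul_of_pos_left hd (Nat.pos_of_ne_zero hp))
  rw [mul_pow, ← pow_mul, mul_comm d p] at h2
  have h3 := coeff_X_pow_mul (g ^ p) (p * d) 0
  rw [zero_add] at h3
  rw [h3, coeff_zero_eq_eval_zero, eval_pow] at h2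
  have h4 := coeff_X_pow_mul g d 0
  rw [zero_add] at h4
  rw [h4, coeff_zero_eq_eval_zero] at hne
  exact hne (pow_eq_zero_iff hp |>.1 h2)

namespace TruncatedPresentation

variable {p : ℕ} [hp : Fact p.Prime] {k : Type u} [CommRing k] {S : Type v} [CommRing S]
  {T : RingTower.{u}} {e : S ≃+* T.obj 0} {I0 : Ideal S} (P : TruncatedPresentation p k T e I0)

include P

theorem isPurelyInseparableTower [IsReduced k] (hpI : (p : S) ∈ I0) :
    IsPurelyInseparableTower p T e I0 where
  p_mem := hpI
  injective i := by
    rw [injective_iff_map_eq_zero]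
    intro a ha
    obtain ⟨f, rfl⟩ := P.surj i a
    rw [P.redMap_s, ← map_pow, P.ker, P.n_succ,
      Polynomial.X_pow_mul_dvd_pow_iff hp.out.ne_zero] at ha
    rwa [P.ker]
  frobenius_mem i x := by
    obtain ⟨f, rfl⟩ := P.surj (i + 1) x
    exact ⟨P.s i f, P.redMap_s i f⟩

/-- Both sides have image `P.s (i + 1) f ^ p` under the injective transition map. So F_i is plain
truncation and leaves coefficients alone. -/
theorem frobProj_s (h : IsPurelyInseparableTower p T e I0) (i : ℕ) (f : k[X]) :
    h.frobProj i (P.s (i + 1) f) = P.s i f :=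
  h.injective i (by rw [h.redMap_frobProj, P.redMap_s])

omit hp in
theorem n_eq (i : ℕ) : P.n i = p ^ i * P.n 0 := by
  induction i with
  | zero => simp
  | succ i ih => rw [P.n_succ, ih, pow_succ]; ring

/-- Makes the coefficient of X^d visible at level `max i d`, so that a power series is recovered
from its truncations. -/
theorem lt_n (i : ℕ) : i < P.n i := by
  rw [P.n_eq]
  exact (Nat.lt_pow_self hp.out.one_lt).trans_le (Nat.le_mul_of_pos_right _ P.n_zero_pos)

theorem n_mono {i j : ℕ} (h : i ≤ j) : P.n i ≤ P.n j := by
  rw [P.n_eq, P.n_eq j]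
  exact Nat.mul_le_mul_right _ (Nat.pow_le_pow_right hp.out.pos h)

omit hp in
theorem s_eq_iff (i : ℕ) (f g : k[X]) :
    P.s i f = P.s i g ↔ ∀ d < P.n i, f.coeff d = g.coeff d := by
  rw [← sub_eq_zero, ← map_sub, P.ker, X_pow_dvd_iff]
  simp only [coeff_sub, sub_eq_zero]

/-- The reduction map from power series. -/
def psMap (i : ℕ) : PowerSeries k →+* T.Red e I0 i where
  toFun f := P.s i (PowerSeries.trunc (P.n i) f)
  map_one' := by
    rw [← map_one (P.s i), s_eq_iff]
    intro d hd
    rw [PowerSeries.coeff_trunc, if_pos hd, PowerSeries.coeff_one, Polynomial.coeff_one]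
  map_zero' := by simp
  map_add' f g := by rw [map_add, map_add]
  map_mul' f g := by
    rw [← map_mul, s_eq_iff]
    intro d hd
    rw [PowerSeries.coeff_trunc, if_pos hd, PowerSeries.coeff_mul_eq_coeff_trunc_mul_trunc _ _ hd,
      ← Polynomial.coe_mul, Polynomial.coeff_coe]

omit hp in
theorem psMap_eq_s {i : ℕ} {f : PowerSeries k} {g : k[X]}
    (h : ∀ d < P.n i, PowerSeries.coeff d f = g.coeff d) : P.psMap i f = P.s i g := by
  refine (P.s_eq_iff i _ _).2 fun d hd => ?_
  rw [PowerSeries.coeff_trunc, if_pos hd, h d hd]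

omit hp in
theorem psMap_eq_s_trunc {i m : ℕ} (hm : P.n i ≤ m) (f : PowerSeries k) :
    P.psMap i f = P.s i (PowerSeries.trunc m f) :=
  P.psMap_eq_s fun d hd => by rw [PowerSeries.coeff_trunc, if_pos (hd.trans_le hm)]

theorem frobProj_psMap (h : IsPurelyInseparableTower p T e I0) (i : ℕ) (f : PowerSeries k) :
    h.frobProj i (P.psMap (i + 1) f) = P.psMap i f := by
  rw [P.psMap_eq_s_trunc le_rfl, P.frobProj_s, ← P.psMap_eq_s_trunc (P.n_mono (Nat.le_succ i))]

theorem redMap_psMap (i : ℕ) (f : PowerSeries k) :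
    T.redMap e I0 i (P.psMap i f) = P.psMap (i + 1) f ^ p := by
  rw [P.psMap_eq_s_trunc (P.n_mono (Nat.le_succ i)), P.redMap_s, ← P.psMap_eq_s_trunc le_rfl]

/-- The map from power series to the small tilt. -/
def toSmallTilt (h : IsPurelyInseparableTower p T e I0) (i : ℕ) :
    PowerSeries k →+* h.smallTilt i :=
  (RingHom.pi fun j : {j : ℕ // i ≤ j} => P.psMap j).codRestrict _
    fun f j _ => P.frobProj_psMap h j f

theorem toSmallTilt_bijective (h : IsPurelyInseparableTower p T e I0) (i : ℕ) :
    Function.Bijective (P.toSmallTilt h i) := by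
  constructor
  · rw [injective_iff_map_eq_zero]
    intro f hf
    ext d
    have h1 : P.psMap (max i d) f = 0 :=
      congrFun (congrArg Subtype.val hf) ⟨max i d, le_max_left i d⟩
    have h2 := (P.s_eq_iff (max i d) (PowerSeries.trunc (P.n (max i d)) f) 0).1
      (by rw [map_zero]; exact h1) d ((le_max_right i d).trans_lt (P.lt_n _))
    rw [PowerSeries.coeff_trunc, if_pos ((le_max_right i d).trans_lt (P.lt_n _))] at h2
    simpa using h2
  · rintro ⟨x, hx⟩
    choose F hF using fun j : {j : ℕ // i ≤ j} => P.surj j (x j)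
    -- The polynomials `F j` are arbitrary lifts, but since the F_i are truncations, compatibility
    -- forces agreement in all degrees below n_j.
    have key : ∀ (j m : ℕ) (hj : i ≤ j), ∀ d < P.n j,
        (F ⟨j + m, hj.trans (Nat.le_add_right j m)⟩).coeff d = (F ⟨j, hj⟩).coeff d := by
      intro j m hj d hd
      induction m with
      | zero => rfl
      | succ m ih =>
        have hjm := hj.trans (Nat.le_add_right j m)
        have h1 := hx (j + m) hjm
        rw [← hF, ← hF] at h1
        rw [← ih]
        exact (P.s_eq_iff (j + m) _ _).1 ((P.frobProj_s h _ _).symm.trans h1) d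
          (hd.trans_le (P.n_mono (Nat.le_add_right j m)))
    have key2 : ∀ (j l : ℕ) (hj : i ≤ j) (hl : i ≤ l), ∀ d, d < P.n j → d < P.n l →
        (F ⟨j, hj⟩).coeff d = (F ⟨l, hl⟩).coeff d := by
      intro j l hj hl d hdj hdl
      rcases le_total j l with hjl | hjl
      · obtain ⟨m, rfl⟩ := Nat.exists_eq_add_of_le hjl
        exact (key j m hj d hdj).symm
      · obtain ⟨m, rfl⟩ := Nat.exists_eq_add_of_le hjl
        exact key l m hl d hdl
    refine ⟨PowerSeries.mk fun d => (F ⟨max i d, le_max_left i d⟩).coeff d, Subtype.ext ?_⟩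
    funext ⟨j, hj⟩
    refine Eq.trans ?_ (hF ⟨j, hj⟩)
    refine P.psMap_eq_s fun d hd => ?_
    rw [PowerSeries.coeff_mk]
    exact key2 _ _ _ _ d ((le_max_right i d).trans_lt (P.lt_n _)) hd

theorem nonempty_tiltIso (h : IsPurelyInseparableTower p T e I0)
    (hk : ((p : ℕ) : PowerSeries k) = 0) :
    Nonempty (TowerIso h.tilt (frobeniusTower p (PowerSeries k) hk)) := by
  have comm : ∀ i (f : PowerSeries k),
      h.tilt.map i (P.toSmallTilt h i f) = P.toSmallTilt h (i + 1) (f ^ p) := by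
    intro i f
    refine Subtype.ext (funext ?_)
    rintro ⟨j, hj⟩
    cases j with
    | zero => exact absurd hj (Nat.not_succ_le_zero i)
    | succ j =>
      refine (P.redMap_psMap j f).trans ?_
      rw [← map_pow]
      rfl
  refine ⟨⟨fun i => (RingEquiv.ofBijective _ (P.toSmallTilt_bijective h i)).symm, ?_⟩⟩
  intro i x
  obtain ⟨f, rfl⟩ := (P.toSmallTilt_bijective h i).2 x
  have h1 : (RingEquiv.ofBijective _ (P.toSmallTilt_bijective h i)).symm (P.toSmallTilt h i f) = f :=
    (RingEquiv.ofBijective _ (P.toSmallTilt_bijective h i)).symm_apply_apply f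
  refine Eq.trans ?_ (congrArg (fun y : PowerSeries k => y ^ p) h1.symm)
  exact (RingEquiv.ofBijective _ (P.toSmallTilt_bijective h (i + 1))).symm_apply_eq.2 (comm i f)

/-- The kernel of truncation is (X^{n_i}), generated by the image of ϖ by `hs`. The terms being
p-torsion-free, the torsion sets are {0} and the required bijections are between one-point sets. -/
theorem isPerfectoidTower [IsReduced k] (hI0 : I0 = Ideal.span {(p : S)})
    (htf : ∀ i, IsPTorsionFree p (T.obj i))
    (hzar : ∀ i, IsZariskian (Ideal.span {(p : T.obj i)})) (ϖ : T.obj 1)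
    (hϖ : Ideal.span {ϖ ^ p} = Ideal.span {(p : T.obj 1)})
    (hs : ∀ i, Ideal.Quotient.mk (T.extIdeal e I0 (i + 1))
      (T.trans 1 (i + 1) (Nat.le_add_left 1 i) ϖ) = P.s (i + 1) (X ^ P.n i)) :
    IsPerfectoidTower p T e I0 := by
  have hext : ∀ i, T.extIdeal e I0 i = Ideal.span {(p : T.obj i)} := fun i => by
    rw [extIdeal, hI0, Ideal.map_span, Set.image_singleton, map_natCast]
  have htors : ∀ i, powTorsion (T.extIdeal e I0 i) = {0} := fun i => by
    ext x
    refine ⟨?_, fun hx => ⟨0, fun a _ => by rw [hx, mul_zero]⟩⟩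
    rintro ⟨m, hm⟩
    have h1 : (p : T.obj i) ^ m * x = 0 :=
      hm _ (Ideal.pow_mem_pow (by rw [hext]; exact Ideal.mem_span_singleton_self _) m)
    clear hm
    induction m with
    | zero => simpa using h1
    | succ m ih => exact ih (htf i _ (by rw [← h1]; ring))
  have hins := P.isPurelyInseparableTower (by rw [hI0]; exact Ideal.mem_span_singleton_self _)
  refine { hins with
    surjective := fun i x => ?_
    zariskian := fun i => by rw [hext]; exact hzar i
    principal := ⟨(p : S), by rw [hI0]⟩
    pillar := ⟨Ideal.span {ϖ}, ⟨ϖ, rfl⟩, ?_, fun i => ?_⟩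
    torsion_eq := fun i => ?_
    torsion_bij := fun i => ?_ }
  · obtain ⟨f, rfl⟩ := P.surj i x
    exact ⟨P.s (i + 1) f, P.frobProj_s hins i f⟩
  · rw [hext, ← hϖ]
    refine le_antisymm (Ideal.span_le.2 ?_) (Ideal.span_mono ?_)
    · rintro _ ⟨x, hx, rfl⟩
      obtain ⟨y, rfl⟩ := Ideal.mem_span_singleton.1 hx
      exact Ideal.mem_span_singleton.2 ⟨y ^ p, mul_pow _ _ _⟩
    · rintro _ rfl
      exact ⟨ϖ, Ideal.mem_span_singleton_self _, rfl⟩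
  · rw [Ideal.map_span, Set.image_singleton, RingHom.comp_apply, hs]
    ext x
    obtain ⟨f, rfl⟩ := P.surj (i + 1) x
    rw [RingHom.mem_ker, P.frobProj_s hins, P.ker, Ideal.mem_span_singleton]
    refine ⟨fun hd => map_dvd _ hd, ?_⟩
    rintro ⟨y, hy⟩
    obtain ⟨g, rfl⟩ := P.surj (i + 1) y
    rw [← map_mul, ← sub_eq_zero, ← map_sub, P.ker] at hy
    have h2 := (pow_dvd_pow X (P.n_mono (Nat.le_succ i))).trans hy
    exact (dvd_sub_left (dvd_mul_right _ _)).1 h2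
  · rw [htors]
    ext x
    refine ⟨?_, fun hx => ?_⟩
    · rintro rfl a _
      exact mul_zero a
    · exact htf i _ (hx _ (by rw [hext]; exact Ideal.mem_span_singleton_self _))
  · have hz : ∀ j (x : powTorsion (T.extIdeal e I0 j)), x.1 = 0 := fun j x =>
      (htors j).le x.2
    have h0 : ∀ j, (0 : T.obj j) ∈ powTorsion (T.extIdeal e I0 j) := fun j => by
      rw [htors]; rfl
    refine ⟨fun _ => ⟨0, h0 i⟩, ⟨fun x y _ => Subtype.ext ?_, fun y => ⟨⟨0, h0 _⟩, Subtype.ext ?_⟩⟩,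
      fun x => ?_⟩
    · rw [hz, hz]
    · exact (hz _ y).symm
    · rw [hz _ x]
      simp only [map_zero]

end TruncatedPresentation
end

/-! ### Maps that are isomorphisms modulo all powers of p, and completions -/

noncomputable section

/-- A ring homomorphism inducing bijections modulo all powers of `p`. -/
def IsIsoModPPow (p : ℕ) {A : Type*} {B : Type*} [CommRing A] [CommRing B] (f : A →+* B) : Prop :=
  ∀ n, (∀ a, (p : B) ^ n ∣ f a → (p : A) ^ n ∣ a) ∧ ∀ b, ∃ a, (p : B) ^ n ∣ f a - b

theorem AdicCompletion.factorPow_evalₐ {A : Type*} [CommRing A] (I : Ideal A) {m n : ℕ}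
    (h : m ≤ n) (x : AdicCompletion I A) :
    Ideal.Quotient.factorPow I h (AdicCompletion.evalₐ I n x) = AdicCompletion.evalₐ I m x := by
  induction x using AdicCompletion.induction_on with
  | h x =>
    rw [evalₐ_mk, evalₐ_mk]
    exact (AdicCompletion.Ideal.mk_eq_mk I h x)

namespace IsIsoModPPow

variable {p : ℕ} {A : Type u} {B : Type v} [CommRing A] [CommRing B] {f : A →+* B}

theorem ofEquiv (p : ℕ) (e : A ≃+* B) : IsIsoModPPow p (e : A →+* B) := fun n =>
  ⟨fun a ⟨c, hc⟩ => ⟨e.symm c, e.injective (by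
    rw [map_mul, map_pow, map_natCast, e.apply_symm_apply]; exact hc)⟩,
    fun b => ⟨e.symm b, by simp⟩⟩

theorem comp {C : Type*} [CommRing C] {g : B →+* C} (hg : IsIsoModPPow p g)
    (hf : IsIsoModPPow p f) : IsIsoModPPow p (g.comp f) := fun n =>
  ⟨fun a ha => (hf n).1 a ((hg n).1 _ ha), fun c => by
    obtain ⟨b, hb⟩ := (hg n).2 c
    obtain ⟨a, ha⟩ := (hf n).2 b
    refine ⟨a, ?_⟩
    have := map_dvd g ha
    rw [map_pow, map_natCast, map_sub] at this
    simpa using dvd_add this hb⟩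

/-- The map induced modulo `p ^ n`. -/
def quotMap (p : ℕ) (f : A →+* B) (n : ℕ) :
    A ⧸ Ideal.span {(p : A)} ^ n →+* B ⧸ Ideal.span {(p : B)} ^ n :=
  Ideal.quotientMap _ f (by
    rw [← Ideal.map_le_iff_le_comap, Ideal.map_pow, Ideal.map_span, Set.image_singleton,
      map_natCast])

theorem quotMap_bijective (h : IsIsoModPPow p f) (n : ℕ) :
    Function.Bijective (quotMap p f n) := by
  constructor
  · refine Ideal.quotientMap_injective' fun a ha => ?_
    rw [Ideal.mem_comap, Ideal.span_singleton_pow, Ideal.mem_span_singleton] at ha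
    rw [Ideal.span_singleton_pow, Ideal.mem_span_singleton]
    exact (h n).1 a ha
  · intro y
    obtain ⟨b, rfl⟩ := Ideal.Quotient.mk_surjective y
    obtain ⟨a, ha⟩ := (h n).2 b
    refine ⟨Ideal.Quotient.mk _ a, Ideal.Quotient.eq.2 ?_⟩
    rwa [Ideal.span_singleton_pow, Ideal.mem_span_singleton]

theorem factorPow_quotMap {m n : ℕ} (hmn : m ≤ n) (x : A ⧸ Ideal.span {(p : A)} ^ n) :
    Ideal.Quotient.factorPow _ hmn (quotMap p f n x) =
      quotMap p f m (Ideal.Quotient.factorPow _ hmn x) := by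
  obtain ⟨a, rfl⟩ := Ideal.Quotient.mk_surjective x
  rfl

/-- The isomorphism modulo `p ^ n`. -/
def quotEquiv (h : IsIsoModPPow p f) (n : ℕ) :
    A ⧸ Ideal.span {(p : A)} ^ n ≃+* B ⧸ Ideal.span {(p : B)} ^ n :=
  RingEquiv.ofBijective _ (h.quotMap_bijective n)

theorem factorPow_quotEquiv (h : IsIsoModPPow p f) {m n : ℕ} (hmn : m ≤ n)
    (x : A ⧸ Ideal.span {(p : A)} ^ n) :
    Ideal.Quotient.factorPow _ hmn (h.quotEquiv n x) =
      h.quotEquiv m (Ideal.Quotient.factorPow _ hmn x) :=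
  factorPow_quotMap hmn x

theorem factorPow_comp_quotEquiv (h : IsIsoModPPow p f) {m n : ℕ} (hmn : m ≤ n) :
    (Ideal.Quotient.factorPow _ hmn).comp ((h.quotEquiv n).toRingHom.comp
      (AdicCompletion.evalₐ (Ideal.span {(p : A)}) n).toRingHom) =
    (h.quotEquiv m).toRingHom.comp (AdicCompletion.evalₐ (Ideal.span {(p : A)}) m).toRingHom :=
  RingHom.ext fun x => (h.factorPow_quotEquiv hmn _).trans
    (congrArg _ (AdicCompletion.factorPow_evalₐ _ hmn x))

theorem factorPow_comp_quotEquiv_symm (h : IsIsoModPPow p f) {m n : ℕ} (hmn : m ≤ n) :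
    (Ideal.Quotient.factorPow _ hmn).comp ((h.quotEquiv n).symm.toRingHom.comp
      (AdicCompletion.evalₐ (Ideal.span {(p : B)}) n).toRingHom) =
    (h.quotEquiv m).symm.toRingHom.comp
      (AdicCompletion.evalₐ (Ideal.span {(p : B)}) m).toRingHom :=
  RingHom.ext fun x => (h.quotEquiv m).injective <|
    (h.factorPow_quotEquiv hmn _).symm.trans <| by simp [AdicCompletion.factorPow_evalₐ]

/-- The isomorphism of completions. -/
def completionEquiv (h : IsIsoModPPow p f) : PCompletion p A ≃+* PCompletion p B :=
  RingEquiv.ofRingHom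
    (AdicCompletion.liftRingHom _ _ h.factorPow_comp_quotEquiv)
    (AdicCompletion.liftRingHom _ _ h.factorPow_comp_quotEquiv_symm)
    (RingHom.ext fun x => AdicCompletion.ext_evalₐ fun n =>
      (AdicCompletion.evalₐ_liftRingHom _ _ h.factorPow_comp_quotEquiv n _).trans
        ((congrArg (h.quotEquiv n)
          (AdicCompletion.evalₐ_liftRingHom _ _ h.factorPow_comp_quotEquiv_symm n x)).trans
          ((h.quotEquiv n).apply_symm_apply _)))
    (RingHom.ext fun x => AdicCompletion.ext_evalₐ fun n =>
      (AdicCompletion.evalₐ_liftRingHom _ _ h.factorPow_comp_quotEquiv_symm n _).trans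
        ((congrArg (h.quotEquiv n).symm
          (AdicCompletion.evalₐ_liftRingHom _ _ h.factorPow_comp_quotEquiv n x)).trans
          ((h.quotEquiv n).symm_apply_apply _)))

end IsIsoModPPow
end

/-! ### An Eisenstein argument without integral closedness -/

noncomputable section

open Polynomial

/-- A monic integral polynomial of the form `X ^ n + p h` of degree `n > 0` with `h(0)` a unit. -/
structure IsUniformizerPoly (p n : ℕ) (g : ℤ[X]) : Prop where
  pos : 0 < n
  monic : g.Monic
  natDegree_eq : g.natDegree = n
  exists_eq : ∃ h : ℤ[X], g = X ^ n + C (p : ℤ) * h ∧ IsUnit (h.coeff 0)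

theorem Polynomial.exists_eq_C_mul_add_X_pow_mul {A : Type*} [CommRing A] (a : A) (f : A[X]) (j : ℕ)
    (h : ∀ i < j, a ∣ f.coeff i) : ∃ u w : A[X], f = C a * u + X ^ j * w := by
  have h1 : X ^ j ∣ f.map (Ideal.Quotient.mk (Ideal.span {a})) := X_pow_dvd_iff.2 fun i hi => by
    rw [coeff_map, Ideal.Quotient.eq_zero_iff_mem, Ideal.mem_span_singleton]
    exact h i hi
  obtain ⟨w', hw'⟩ := h1
  obtain ⟨w, rfl⟩ := Polynomial.map_surjective _ Ideal.Quotient.mk_surjective w'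
  have h2 : C a ∣ f - X ^ j * w := by
    rw [C_dvd_iff_dvd_coeff]
    intro i
    rw [← Ideal.mem_span_singleton, ← Ideal.Quotient.eq_zero_iff_mem, ← coeff_map,
      Polynomial.map_sub, Polynomial.map_mul, Polynomial.map_pow, map_X, hw', sub_self, coeff_zero]
  obtain ⟨u, hu⟩ := h2
  exact ⟨u, w, by rw [← hu]; ring⟩

/-- If r is a monic equation of degree d for c, then b = ac is a root of `r.scaleRoots a`, which is
X^d modulo a, so a divides b^d. Primality of a replaces integral closedness of A. -/
theorem RingHom.IsIntegralElem.dvd_of_prime_of_mul_eq {A L : Type*} [CommRing A] [CommRing L]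
    {ε : A →+* L} (hε : Function.Injective ε) {a b : A} (ha : Prime a) {c : L}
    (hc : ε.IsIntegralElem c) (h : ε a * c = ε b) : a ∣ b := by
  obtain ⟨r, hr, hr0⟩ := hc
  have h1 : (r.scaleRoots a).eval b = 0 := hε <| by
    rw [map_zero, ← eval₂_at_apply, ← h]
    exact scaleRoots_eval₂_eq_zero ε hr0
  have h2 : (r.scaleRoots a).map (Ideal.Quotient.mk (Ideal.span {a})) = X ^ r.natDegree := by
    ext i
    rw [coeff_map, coeff_scaleRoots, coeff_X_pow]
    split_ifs with hi
    · rw [hi, Nat.sub_self, pow_zero, mul_one, coeff_natDegree, hr.leadingCoeff, map_one]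
    · rw [Ideal.Quotient.eq_zero_iff_mem, Ideal.mem_span_singleton]
      rcases lt_or_gt_of_ne hi with hlt | hgt
      · exact Dvd.dvd.mul_left (dvd_pow_self a (Nat.sub_ne_zero_of_lt hlt)) _
      · rw [coeff_eq_zero_of_natDegree_lt hgt, zero_mul]
        exact dvd_zero _
  have h3 := congrArg (Ideal.Quotient.mk (Ideal.span {a})) h1
  rw [← eval_map_apply, h2, eval_pow, eval_X, map_zero, ← map_pow,
    Ideal.Quotient.eq_zero_iff_mem, Ideal.mem_span_singleton] at h3
  exact ha.dvd_of_dvd_pow h3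

namespace IsUniformizerPoly

variable {p n : ℕ} {g : ℤ[X]} (hg : IsUniformizerPoly p n g)
include hg

/-- By induction f = p u + X^j w, and w(0) is the j-th coefficient of f modulo p. The relation f(y)
= 0 together with y^n = -p h(y) puts w(0) in y A[y], hence w(0)^n in p A[y]. As A[y] is integral
over A and p is prime, p divides w(0). -/
theorem dvd_coeff_of_eval₂_eq_zero {A L : Type*} [CommRing A] [Field L] {ε : A →+* L}
    (hε : Function.Injective ε) (hp : Prime (p : A)) {y : L} (hy : aeval y g = 0)
    {f : A[X]} (hf : f.eval₂ ε y = 0) (j : ℕ) (hj : j < n) : (p : A) ∣ f.coeff j := by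
  induction j using Nat.strong_induction_on with
  | _ j ih =>
    obtain ⟨u, w, huw⟩ := exists_eq_C_mul_add_X_pow_mul (p : A) f j fun i hi => ih i hi (hi.trans hj)
    obtain ⟨h, hgh, hh⟩ := hg.exists_eq
    set E : A[X] →+* L := eval₂RingHom ε y with hE
    have hEX : E X = y := eval₂_X _ _
    have hEC : ∀ a, E (C a) = ε a := fun a => eval₂_C _ _
    have hp0 : (p : L) ≠ 0 := fun h0 => hp.ne_zero (hε (by rw [map_natCast, h0, map_zero]))
    set h' : A[X] := h.map (Int.castRingHom A) with hh'
    have hEh : E h' = aeval y h := by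
      rw [hE, coe_eval₂RingHom, hh', eval₂_map, aeval_def]
      exact congrArg (fun φ => eval₂ φ y h) (RingHom.ext_int _ _)
    have hyn : E X ^ n = - ((p : L) * E h') := by
      rw [hEh, hEX, eq_neg_iff_add_eq_zero, ← hy, hgh]
      simp
    have h1 : (p : L) * E u + y ^ j * E w = 0 := by
      have : E f = 0 := hf
      rw [huw, map_add, map_mul, hEC, map_natCast, map_mul, map_pow, hEX] at this
      exact this
    -- Multiply p u(y) = -y^j w(y) by y^{n-j}, replace y^n by -p h(y), and cancel p.
    have h2 : E h' * E w = E (X * (X ^ (n - j - 1) * u)) := by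
      apply mul_left_cancel₀ hp0
      have e1 : (E X) ^ n = E X * E X ^ (n - j - 1) * E X ^ j := by
        rw [← pow_succ', ← pow_add]
        congr 1
        omega
      calc (p : L) * (E h' * E w) = - (E X ^ n) * E w := by rw [hyn]; ring
        _ = E X * E X ^ (n - j - 1) * (p * E u - (p * E u + E X ^ j * E w)) := by rw [e1]; ring
        _ = _ := by rw [hEX, h1, ← hEX, map_mul, map_mul, map_pow]; ring
    have hh0 : IsUnit (h'.coeff 0) := by rw [hh', coeff_map]; exact hh.map _
    obtain ⟨b, hb⟩ := hh0.exists_left_inv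
    -- Read `h2` modulo y: h(0) w(0) lies in y A[y], and h(0) is a unit with inverse b.
    have h3 : ∃ q : A[X], ε (w.coeff 0) = y * E q := by
      refine ⟨C b * (X ^ (n - j - 1) * u - h'.divX * w - C (h'.coeff 0) * w.divX), ?_⟩
      have e1 := divX_mul_X_add h'
      have e2 := divX_mul_X_add w
      have e3 : ε (w.coeff 0) = E (C b * (C (h'.coeff 0) * C (w.coeff 0))) := by
        rw [← mul_assoc, ← C_mul, hb, C_1, one_mul, hEC]
      rw [e3, ← hEX]
      have e4 : C b * (C (h'.coeff 0) * C (w.coeff 0)) = C b * (h' * w) -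
          X * (C b * (h'.divX * w + C (h'.coeff 0) * w.divX)) := by
        have e5 : C (w.coeff 0) = w - w.divX * X := by rw [eq_sub_iff_add_eq, add_comm, e2]
        have e6 : C (h'.coeff 0) = h' - h'.divX * X := by rw [eq_sub_iff_add_eq, add_comm, e1]
        rw [e5, e6]
        ring
      rw [e4, map_sub, map_mul E (C b) (h' * w), map_mul E h' w, h2]
      simp only [← map_mul, ← map_sub]
      congr 1
      ring
    obtain ⟨q, hq⟩ := h3
    have h4 : ε (p : A) * E (-(h' * q ^ n)) = ε (w.coeff 0 ^ n) := by
      rw [map_pow, hq, mul_pow, ← hEX, hyn, map_natCast, map_neg, map_mul, map_pow]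
      ring
    have hyint : ε.IsIntegralElem y := ⟨g.map (Int.castRingHom A), hg.monic.map _, by
      rw [eval₂_map]
      exact (congrArg (fun φ => eval₂ φ y g) (RingHom.ext_int _ _)).trans hy⟩
    have h5 : ∀ r : A[X], ε.IsIntegralElem (E r) := fun r => by
      induction r using Polynomial.induction_on' with
      | add a b ha hb => rw [map_add]; exact ha.add _ hb
      | monomial k a =>
        rw [← C_mul_X_pow_eq_monomial, map_mul, map_pow, hEX, hEC]
        refine RingHom.IsIntegralElem.mul _ (ε.isIntegralElem_map) ?_
        induction k with
        | zero => rw [pow_zero]; exact ε.isIntegralElem_one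
        | succ k ihk => rw [pow_succ]; exact ihk.mul _ hyint
    have h6 : (p : A) ∣ w.coeff 0 :=
      hp.dvd_of_dvd_pow ((h5 _).dvd_of_prime_of_mul_eq hε hp h4)
    rw [huw, coeff_add, coeff_C_mul]
    refine dvd_add (dvd_mul_right _ _) ?_
    have := coeff_X_pow_mul w j 0
    rw [zero_add] at this
    rwa [this]

/-- All coefficients are divisible by p, and the quotient by p satisfies the same hypotheses, so
they are divisible by every power of p. -/
theorem eq_zero_of_eval₂_eq_zero {A L : Type*} [CommRing A] [Field L] {ε : A →+* L}
    (hε : Function.Injective ε) (hp : Prime (p : A)) (hsep : ∀ a : A, (∀ m, (p : A) ^ m ∣ a) → a = 0)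
    {y : L} (hy : aeval y g = 0) {f : A[X]} (hf : f.eval₂ ε y = 0) (hfn : ∀ j, n ≤ j → f.coeff j = 0) :
    f = 0 := by
  have hp0 : (p : L) ≠ 0 := fun h0 => hp.ne_zero (hε (by rw [map_natCast, h0, map_zero]))
  have key : ∀ m (f : A[X]), f.eval₂ ε y = 0 → (∀ j, n ≤ j → f.coeff j = 0) →
      ∀ j, (p : A) ^ m ∣ f.coeff j := by
    intro m
    induction m with
    | zero => intro f _ _ j; rw [pow_zero]; exact one_dvd _
    | succ m ih =>
      intro f hf hfn j
      have h1 : C (p : A) ∣ f := by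
        rw [C_dvd_iff_dvd_coeff]
        intro i
        rcases lt_or_ge i n with hi | hi
        · exact hg.dvd_coeff_of_eval₂_eq_zero hε hp hy hf i hi
        · rw [hfn i hi]; exact dvd_zero _
      obtain ⟨f', rfl⟩ := h1
      rw [coeff_C_mul, pow_succ']
      refine mul_dvd_mul_left _ (ih f' ?_ (fun i hi => ?_) j)
      · rw [eval₂_mul, eval₂_C, map_natCast] at hf
        exact (mul_eq_zero.1 hf).resolve_left hp0
      · have h2 := hfn i hi
        rw [coeff_C_mul] at h2
        refine hε ?_
        have h3 := congrArg ε h2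
        rw [map_mul, map_natCast, map_zero] at h3
        rw [map_zero]
        exact (mul_eq_zero.1 h3).resolve_left hp0
  ext j
  exact hsep _ fun m => key m f hf hfn j

/-- Apply `eq_zero_of_eval₂_eq_zero` to the remainder modulo the monic g. It serves for ℤ in `QBar`
and for R in the fraction field of R^+. -/
theorem eval₂_eq_zero_iff {A L : Type*} [CommRing A] [Field L] {ε : A →+* L}
    (hε : Function.Injective ε) (hp : Prime (p : A)) (hsep : ∀ a : A, (∀ m, (p : A) ^ m ∣ a) → a = 0)
    {y : L} (hy : aeval y g = 0) {f : A[X]} :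
    f.eval₂ ε y = 0 ↔ g.map (Int.castRingHom A) ∣ f := by
  have hgm : (g.map (Int.castRingHom A)).Monic := hg.monic.map _
  have hgy : (g.map (Int.castRingHom A)).eval₂ ε y = 0 := by
    rw [eval₂_map]
    exact (congrArg (fun φ => eval₂ φ y g) (RingHom.ext_int _ _)).trans hy
  refine ⟨fun hf => ?_, ?_⟩
  · have : Nontrivial A := ⟨(p : A), 0, hp.ne_zero⟩
    rw [← modByMonic_eq_zero_iff_dvd hgm]
    refine hg.eq_zero_of_eval₂_eq_zero hε hp hsep hy ?_ fun j hj => ?_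
    · rw [modByMonic_eq_sub_mul_div, eval₂_sub, eval₂_mul, hf, hgy, zero_mul, sub_zero]
    · refine coeff_eq_zero_of_degree_lt ((degree_modByMonic_lt f hgm).trans_le ?_)
      rw [degree_eq_natDegree hgm.ne_zero, hg.monic.natDegree_map, hg.natDegree_eq]
      exact_mod_cast hj
  · rintro ⟨q, rfl⟩
    rw [eval₂_mul, hgy, zero_mul]

end IsUniformizerPoly

theorem isUniformizerPoly_X_pow_sub (p : ℕ) {n : ℕ} (hn : 0 < n) :
    IsUniformizerPoly p n (X ^ n - C (p : ℤ)) where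
  pos := hn
  monic := monic_X_pow_sub_C _ hn.ne'
  natDegree_eq := natDegree_X_pow_sub_C
  exists_eq := ⟨-1, by ring, by simp⟩

/-- The Eisenstein property at p gives the shape X^n + p h. The constant term is Φ_{p^{i+1}}(1) = p,
so h(0) = 1. -/
theorem isUniformizerPoly_cyclotomic (p : ℕ) [hp : Fact p.Prime] (i : ℕ) :
    IsUniformizerPoly p (p ^ i * (p - 1)) ((cyclotomic (p ^ (i + 1)) ℤ).comp (X + 1)) := by
  have hmon : ((cyclotomic (p ^ (i + 1)) ℤ).comp (X + 1)).Monic := by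
    rw [← C_1]
    exact (cyclotomic.monic _ ℤ).comp_X_add_C 1
  have hdeg : ((cyclotomic (p ^ (i + 1)) ℤ).comp (X + 1)).natDegree = p ^ i * (p - 1) := by
    rw [natDegree_comp, ← C_1, natDegree_X_add_C, mul_one, natDegree_cyclotomic,
      Nat.totient_prime_pow_succ hp.out]
  have heis := cyclotomic_prime_pow_comp_X_add_one_isEisensteinAt p i
  refine ⟨Nat.mul_pos (pow_pos hp.out.pos i) (Nat.sub_pos_of_lt hp.out.one_lt), hmon, hdeg, ?_⟩
  have h1 : C (p : ℤ) ∣ (cyclotomic (p ^ (i + 1)) ℤ).comp (X + 1) - X ^ (p ^ i * (p - 1)) := by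
    rw [C_dvd_iff_dvd_coeff]
    intro j
    rw [coeff_sub, coeff_X_pow]
    split_ifs with hj
    · rw [hj, ← hdeg, coeff_natDegree, hmon.leadingCoeff, sub_self]
      exact dvd_zero _
    · rw [sub_zero]
      rcases lt_or_gt_of_ne hj with hlt | hgt
      · have := heis.mem (hdeg.symm ▸ hlt)
        exact Ideal.mem_span_singleton.1 this
      · rw [coeff_eq_zero_of_natDegree_lt (hdeg.symm ▸ hgt)]
        exact dvd_zero _
  obtain ⟨h, hh⟩ := h1
  refine ⟨h, by rw [← hh]; ring, ?_⟩
  have h2 := congrArg (coeff · 0) hh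
  have hpos : p ^ i * (p - 1) ≠ 0 :=
    (Nat.mul_pos (pow_pos hp.out.pos i) (Nat.sub_pos_of_lt hp.out.one_lt)).ne'
  simp only [coeff_sub, coeff_C_mul, coeff_X_pow, hpos.symm, if_false, sub_zero] at h2
  rw [coeff_zero_eq_eval_zero, eval_comp, eval_add, eval_X, eval_one, zero_add,
    eval_one_cyclotomic_prime_pow] at h2
  have hp0 : (p : ℤ) ≠ 0 := by exact_mod_cast hp.out.ne_zero
  rw [(mul_right_eq_self₀.1 h2.symm).resolve_right hp0]
  exact isUnit_one
end

/-! ### The rings A ⊗ ℤ[x] as A[X]/(g) -/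

noncomputable section

open Polynomial

/-- Here y^n = -p h(y). Every maximal ideal contains p, hence y, so h(y) = h(0) + y(⋯) is a unit. -/
theorem IsUniformizerPoly.span_pow_eq {p n : ℕ} {g : ℤ[X]} (hg : IsUniformizerPoly p n g)
    {B : Type*} [CommRing B] (hB : IsZariskian (Ideal.span {(p : B)})) {y : B}
    (hy : aeval y g = 0) : Ideal.span {y ^ n} = Ideal.span {(p : B)} := by
  obtain ⟨h, hgh, hu⟩ := hg.exists_eq
  have hyn : y ^ n = p * (-aeval y h) := by
    rw [hgh, map_add, map_pow, aeval_X, map_mul, aeval_C, ← eq_neg_iff_add_eq_zero] at hy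
    rw [hy, mul_neg, eq_intCast, Int.cast_natCast]
  have hyJ : y ∈ Ideal.jacobson (⊥ : Ideal B) := by
    rw [Ideal.jacobson, Ideal.mem_sInf]
    rintro M ⟨-, hM⟩
    refine hM.isPrime.mem_of_pow_mem n ?_
    rw [hyn]
    exact M.mul_mem_right _ ((hB.trans (sInf_le ⟨bot_le, hM⟩)) (Ideal.mem_span_singleton_self _))
  have hH : IsUnit (-aeval y h) := by
    rw [IsUnit.neg_iff]
    obtain ⟨b, hb⟩ := hu.exists_right_inv
    have h1 : aeval y h = ((h.coeff 0 : ℤ) : B) + y * aeval y h.divX := by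
      conv_lhs => rw [← divX_mul_X_add h]
      rw [map_add, map_mul, aeval_X, aeval_C, eq_intCast, add_comm, mul_comm]
    have h2 : IsUnit (aeval y h * (b : B)) := by
      rw [h1, add_mul, ← Int.cast_mul, hb, mul_assoc, Int.cast_one, add_comm]
      exact Ideal.mem_jacobson_bot.1 hyJ _
    exact isUnit_of_mul_isUnit_left h2
  rw [hyn, Ideal.span_singleton_mul_right_unit hH]

/-- The algebraic number `x - c` is a root of the uniformizer polynomial `g`. -/
structure IsUniformizer (p n : ℕ) (x : QBar) (c : ℤ) (g : ℤ[X]) : Prop where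
  poly : IsUniformizerPoly p n g
  root : aeval (x - c) g = 0

/-- The element `x - c` of `ℤ[x]`. -/
def ZAdjoin.gen (x : QBar) (c : ℤ) : ZAdjoin x :=
  ⟨x, Algebra.self_mem_adjoin_singleton ℤ x⟩ - c

/-- The evaluation map `A[X] → A ⊗ ℤ[x]` at `x - c`. -/
def tensorEval (A : Type u) [CommRing A] (x : QBar) (c : ℤ) : A[X] →+* A ⊗[ℤ] ZAdjoin x :=
  eval₂RingHom Algebra.TensorProduct.includeLeftRingHom (1 ⊗ₜ ZAdjoin.gen x c)

theorem tensorEval_C {A : Type u} [CommRing A] (x : QBar) (c : ℤ) (a : A) :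
    tensorEval A x c (C a) = a ⊗ₜ 1 := eval₂_C _ _

theorem tensorEval_X {A : Type u} [CommRing A] (x : QBar) (c : ℤ) :
    tensorEval A x c X = 1 ⊗ₜ ZAdjoin.gen x c := eval₂_X _ _

theorem tensorEval_map_int {A : Type u} [CommRing A] (x : QBar) (c : ℤ) (f : ℤ[X]) :
    tensorEval A x c (f.map (Int.castRingHom A)) = 1 ⊗ₜ aeval (ZAdjoin.gen x c) f := by
  induction f using Polynomial.induction_on' with
  | add f g hf hg => rw [Polynomial.map_add, map_add, map_add, hf, hg, TensorProduct.tmul_add]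
  | monomial k a =>
    rw [← C_mul_X_pow_eq_monomial, Polynomial.map_mul, Polynomial.map_pow, map_X, map_C, map_mul,
      map_pow, tensorEval_C, tensorEval_X, map_mul, map_pow, aeval_X, aeval_C,
      Algebra.TensorProduct.tmul_pow, Algebra.TensorProduct.tmul_mul_tmul, one_pow, mul_one,
      eq_intCast, eq_intCast, ← zsmul_one, TensorProduct.smul_tmul, ← zsmul_eq_mul,
      one_mul]

theorem ZAdjoin.aeval_gen_surjective (x : QBar) (c : ℤ) :
    Function.Surjective (aeval (R := ℤ) (ZAdjoin.gen x c)) := by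
  intro z
  have h1 : z ∈ Algebra.adjoin ℤ {(⟨x, Algebra.self_mem_adjoin_singleton ℤ x⟩ : ZAdjoin x)} := by
    have := Algebra.adjoin_adjoin_coe_preimage (R := ℤ) (s := {x})
    have h2 : ((↑) : ZAdjoin x → QBar) ⁻¹' {x} =
      {(⟨x, Algebra.self_mem_adjoin_singleton ℤ x⟩ : ZAdjoin x)} := by
      ext y; simp [Subtype.ext_iff]
    rw [h2] at this
    rw [this]
    trivial
  have h2 : Algebra.adjoin ℤ {(⟨x, Algebra.self_mem_adjoin_singleton ℤ x⟩ : ZAdjoin x)} ≤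
      (aeval (R := ℤ) (ZAdjoin.gen x c)).range := by
    refine Algebra.adjoin_le (Set.singleton_subset_iff.2 ⟨X + C c, ?_⟩)
    simp [ZAdjoin.gen]
  exact h2 h1

theorem tensorEval_surjective (A : Type u) [CommRing A] (x : QBar) (c : ℤ) :
    Function.Surjective (tensorEval A x c) := by
  intro z
  change z ∈ (tensorEval A x c).range
  induction z using TensorProduct.induction_on with
  | zero => exact zero_mem _
  | add a b ha hb => exact add_mem ha hb
  | tmul a b =>
    obtain ⟨f, rfl⟩ := ZAdjoin.aeval_gen_surjective x c b
    refine ⟨C a * f.map (Int.castRingHom A), ?_⟩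
    rw [map_mul, tensorEval_C, tensorEval_map_int, Algebra.TensorProduct.tmul_mul_tmul, mul_one,
      one_mul]

namespace IsUniformizer

variable {p : ℕ} [hp : Fact p.Prime] {n : ℕ} {x : QBar} {c : ℤ} {g : ℤ[X]}
  (hx : IsUniformizer p n x c g)
include hx

theorem aeval_gen_eq_zero_iff {f : ℤ[X]} : aeval (ZAdjoin.gen x c) f = 0 ↔ g ∣ f := by
  have h1 : aeval (ZAdjoin.gen x c) f = 0 ↔ f.eval₂ (Int.castRingHom QBar) (x - c) = 0 := by
    rw [← Subtype.val_inj, ← Subalgebra.coe_val, ← aeval_algHom_apply, aeval_def,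
      RingHom.ext_int (algebraMap ℤ QBar) (Int.castRingHom QBar)]
    simp [ZAdjoin.gen]
  have hpZ : Prime ((p : ℕ) : ℤ) := Nat.prime_iff_prime_int.1 hp.out
  rw [h1, hx.poly.eval₂_eq_zero_iff (RingHom.injective_int _) hpZ (fun a ha => ?_) hx.root]
  · rw [RingHom.ext_int (Int.castRingHom ℤ) (RingHom.id ℤ), Polynomial.map_id]
  · by_contra h0
    exact (Int.finiteMultiplicity_iff.2 ⟨by simpa using hp.out.ne_one, h0⟩).not_pow_dvd_of_multiplicity_lt
      (Nat.lt_succ_self _) (ha _)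

omit hp in
theorem aeval_gen_self : aeval (ZAdjoin.gen x c) g = 0 := by
  apply Subtype.val_injective
  rw [← Subalgebra.coe_val, ← aeval_algHom_apply]
  simpa [ZAdjoin.gen] using hx.root

/-- The presentation `ℤ[X]/(g) ≃ ℤ[x]`. -/
def adjoinRootEquiv : AdjoinRoot g ≃ₐ[ℤ] ZAdjoin x :=
  AlgEquiv.ofBijective (AdjoinRoot.liftAlgHom g (Algebra.ofId ℤ _) (ZAdjoin.gen x c)
    hx.aeval_gen_self) <| by
    constructor
    · rw [injective_iff_map_eq_zero]
      intro a ha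
      obtain ⟨f, rfl⟩ := AdjoinRoot.mk_surjective a
      rw [AdjoinRoot.mk_eq_zero, ← hx.aeval_gen_eq_zero_iff]
      exact (AdjoinRoot.lift_mk hx.aeval_gen_self f).symm.trans ha
    · intro z
      obtain ⟨f, rfl⟩ := ZAdjoin.aeval_gen_surjective x c z
      exact ⟨AdjoinRoot.mk g f, AdjoinRoot.lift_mk hx.aeval_gen_self f⟩

theorem adjoinRootEquiv_root : hx.adjoinRootEquiv (AdjoinRoot.root g) = ZAdjoin.gen x c :=
  AdjoinRoot.lift_root hx.aeval_gen_self

/-- The basis of powers of `x - c`. -/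
def basis : Module.Basis (Fin g.natDegree) ℤ (ZAdjoin x) :=
  (AdjoinRoot.powerBasis' hx.poly.monic).basis.map hx.adjoinRootEquiv.toLinearEquiv

theorem basis_apply (j : Fin g.natDegree) : hx.basis j = ZAdjoin.gen x c ^ (j : ℕ) := by
  refine (congrArg hx.adjoinRootEquiv
    ((AdjoinRoot.powerBasis' hx.poly.monic).basis_eq_pow j)).trans ?_
  rw [map_pow, AdjoinRoot.powerBasis'_gen, hx.adjoinRootEquiv_root]

theorem free : Module.Free ℤ (ZAdjoin x) := Module.Free.of_basis hx.basis

theorem finite : Module.Finite ℤ (ZAdjoin x) := Module.Finite.of_basis hx.basis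

/-- The powers of x - c of exponent below deg g form a ℤ-basis of ℤ[x], hence an A-basis after base
change. In it the remainder modulo g has its own coefficients as coordinates. Nothing is needed of
A. -/
theorem tensorEval_eq_zero_iff {A : Type u} [CommRing A] {f : A[X]} :
    tensorEval A x c f = 0 ↔ g.map (Int.castRingHom A) ∣ f := by
  have hgm : (g.map (Int.castRingHom A)).Monic := hx.poly.monic.map _
  have hg0 : tensorEval A x c (g.map (Int.castRingHom A)) = 0 := by
    rw [tensorEval_map_int, hx.aeval_gen_self, TensorProduct.tmul_zero]
  refine ⟨fun hf => ?_, fun ⟨q, hq⟩ => by rw [hq, map_mul, hg0, zero_mul]⟩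
  nontriviality A
  rw [← modByMonic_eq_zero_iff_dvd hgm]
  have h1 : tensorEval A x c (f %ₘ g.map (Int.castRingHom A)) = 0 := by
    rw [modByMonic_eq_sub_mul_div, map_sub, map_mul, hf, hg0, zero_mul, sub_zero]
  have hdeg : (f %ₘ g.map (Int.castRingHom A)).natDegree < g.natDegree := by
    have := natDegree_modByMonic_lt f hgm (fun h => by
      have h2 := hx.poly.monic.natDegree_map (Int.castRingHom A)
      rw [h, natDegree_one, hx.poly.natDegree_eq] at h2
      exact hx.poly.pos.ne h2)
    rwa [hx.poly.monic.natDegree_map] at this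
  rw [as_sum_range' _ _ hdeg, map_sum, Finset.sum_range] at h1
  have h2 := Fintype.linearIndependent_iff.1 (hx.basis.baseChange A).linearIndependent
    (fun j => (f %ₘ g.map (Int.castRingHom A)).coeff j) (by
      rw [← h1]
      refine Finset.sum_congr rfl fun j _ => ?_
      rw [Module.Basis.baseChange_apply, hx.basis_apply, ← C_mul_X_pow_eq_monomial, map_mul, map_pow,
        tensorEval_C, tensorEval_X, Algebra.TensorProduct.tmul_pow,
        Algebra.TensorProduct.tmul_mul_tmul, one_pow, mul_one, one_mul, TensorProduct.smul_tmul',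
        smul_eq_mul, mul_one])
  ext j
  rw [coeff_zero]
  rcases lt_or_ge j g.natDegree with hj | hj
  · exact h2 ⟨j, hj⟩
  · exact coeff_eq_zero_of_natDegree_lt (hdeg.trans_le hj)

/-- Since g is X^n modulo p, the reduction of A ⊗ ℤ[x] modulo p is (A/p)[X]/(X^n). -/
theorem natCast_dvd_tensorEval_iff {A : Type u} [CommRing A] {f : A[X]} :
    (p : A ⊗[ℤ] ZAdjoin x) ∣ tensorEval A x c f ↔
      X ^ n ∣ f.map (Ideal.Quotient.mk (Ideal.span {(p : A)})) := by
  obtain ⟨h, hgh, -⟩ := hx.poly.exists_eq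
  have hg' : g.map (Int.castRingHom A) = X ^ n + C (p : A) * h.map (Int.castRingHom A) := by
    rw [hgh]; simp
  have hp0 : Ideal.Quotient.mk (Ideal.span {(p : A)}) (p : A) = 0 :=
    Ideal.Quotient.eq_zero_iff_mem.2 (Ideal.mem_span_singleton_self _)
  have hgmk : (g.map (Int.castRingHom A)).map (Ideal.Quotient.mk (Ideal.span {(p : A)})) = X ^ n := by
    rw [hg', Polynomial.map_add, Polynomial.map_mul, map_C, hp0, Polynomial.map_pow, map_X]
    simp
  constructor
  · rintro ⟨z, hz⟩
    obtain ⟨q, rfl⟩ := tensorEval_surjective A x c z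
    have h1 : tensorEval A x c (f - C (p : A) * q) = 0 := by
      rw [map_sub, hz, map_mul, map_natCast, map_natCast, sub_self]
    rw [hx.tensorEval_eq_zero_iff] at h1
    have h2 := map_dvd (mapRingHom (Ideal.Quotient.mk (Ideal.span {(p : A)}))) h1
    rw [coe_mapRingHom, hgmk, Polynomial.map_sub, Polynomial.map_mul, map_C, hp0, C_0, zero_mul,
      sub_zero] at h2
    exact h2
  · rintro ⟨w, hw⟩
    obtain ⟨w, rfl⟩ := Polynomial.map_surjective _ Ideal.Quotient.mk_surjective w
    have h1 : C (p : A) ∣ f - g.map (Int.castRingHom A) * w := by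
      rw [C_dvd_iff_dvd_coeff]
      intro i
      rw [← Ideal.mem_span_singleton, ← Ideal.Quotient.eq_zero_iff_mem, ← coeff_map,
        Polynomial.map_sub, Polynomial.map_mul, hgmk, hw, sub_self, coeff_zero]
    have h2 := map_dvd (tensorEval A x c) h1
    rwa [map_sub, map_mul, hx.tensorEval_eq_zero_iff.2 dvd_rfl, zero_mul, sub_zero, map_natCast,
      map_natCast] at h2

/-- A ⊗ ℤ[x] is integral over A, so its maximal ideals contract to maximal ideals of A, and these
contain p. -/
theorem isZariskian_tensor {A : Type u} [CommRing A] (hA : IsZariskian (Ideal.span {(p : A)})) :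
    IsZariskian (Ideal.span {(p : A ⊗[ℤ] ZAdjoin x)}) := by
  have := hx.finite
  have hint : Algebra.IsIntegral A (A ⊗[ℤ] ZAdjoin x) := inferInstance
  rw [IsZariskian, Ideal.span_singleton_le_iff_mem, Ideal.jacobson, Ideal.mem_sInf]
  rintro M ⟨-, hM⟩
  have h1 := Ideal.isMaximal_comap_of_isIntegral_of_isMaximal (R := A) M
  have h2 := (hA.trans (sInf_le ⟨bot_le, h1⟩)) (Ideal.mem_span_singleton_self _)
  rwa [Ideal.mem_comap, map_natCast] at h2

omit hp in
theorem span_gen_pow_eq {A : Type u} [CommRing A]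
    (hA : IsZariskian (Ideal.span {(p : A ⊗[ℤ] ZAdjoin x)})) :
    Ideal.span {(1 ⊗ₜ ZAdjoin.gen x c : A ⊗[ℤ] ZAdjoin x) ^ n} =
      Ideal.span {(p : A ⊗[ℤ] ZAdjoin x)} := by
  refine hx.poly.span_pow_eq hA ?_
  have h1 := aeval_algHom_apply
    (Algebra.TensorProduct.includeRight : ZAdjoin x →ₐ[ℤ] A ⊗[ℤ] ZAdjoin x) (ZAdjoin.gen x c) g
  rw [hx.aeval_gen_self, map_zero] at h1
  exact h1

end IsUniformizer
end

/-! ### The rings R^{1/p^i} and R_perf, injectivity of φ, flatness over ℤ -/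

noncomputable section

open Polynomial RingTower

namespace DeltaStructure

variable {p : ℕ} [hp : Fact p.Prime] {R : Type u} [CommRing R] (D : DeltaStructure p R)

theorem frob_apply (a : R) : D.frob a = a ^ p + (p : R) * D.delta a := rfl

theorem toRoot_frob_pow (i : ℕ) (j k : Fin (i + 1)) (h : j ≤ k) (r : R) :
    D.toRoot i k ((D.frob ^ ((k : ℕ) - (j : ℕ))) r) = D.toRoot i j r :=
  Ring.DirectLimit.of_f (G := fun _ : Fin (i + 1) => R)
    (f := fun j k _ => ⇑(D.frob ^ ((k : ℕ) - (j : ℕ)) : R →+* R)) h r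

theorem rootMap_toRoot (i : ℕ) (j : Fin (i + 1)) (r : R) :
    D.rootMap i (D.toRoot i j r) = D.toRoot (i + 1) j.castSucc r :=
  Ring.DirectLimit.lift_of _ _ _ _ _

/-- The projection of `R^{1/p^i}` to its last term. -/
def rootProj (i : ℕ) : D.Root i →+* R :=
  Ring.DirectLimit.lift _ _ _ (fun j => D.frob ^ (i - (j : ℕ))) (fun j k hjk x => by
    have hk := Nat.lt_succ_iff.1 k.2
    have hjk' : (j : ℕ) ≤ k := hjk
    change (D.frob ^ (i - (k : ℕ)) * D.frob ^ ((k : ℕ) - (j : ℕ))) x = _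
    rw [← pow_add]
    congr 2
    omega)

theorem rootProj_toRoot (i : ℕ) (j : Fin (i + 1)) (r : R) :
    D.rootProj i (D.toRoot i j r) = (D.frob ^ (i - (j : ℕ))) r :=
  Ring.DirectLimit.lift_of _ _ _ _ _

/-- The isomorphism of `R` with `R^{1/p^i}` given by the last term. -/
def rootEquiv (i : ℕ) : R ≃+* D.Root i :=
  RingEquiv.ofRingHom (D.toRoot i (Fin.last i)) (D.rootProj i)
    (Ring.DirectLimit.hom_ext _ fun j => RingHom.ext fun r => by
      refine (congrArg (D.toRoot i (Fin.last i)) (D.rootProj_toRoot i j r)).trans ?_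
      exact D.toRoot_frob_pow i j (Fin.last i) (Fin.le_last j) r)
    (RingHom.ext fun r => by
      refine (D.rootProj_toRoot i (Fin.last i) r).trans ?_
      rw [Fin.val_last, Nat.sub_self, pow_zero]
      rfl)

theorem rootEquiv_apply (i : ℕ) (r : R) : D.rootEquiv i r = D.toRoot i (Fin.last i) r := rfl

/-- The reason for identifying R^{1/p^i} with R by the last term and not the first: the transition
map becomes φ itself, which is the Frobenius modulo p. -/
theorem rootMap_rootEquiv (i : ℕ) (r : R) :
    D.rootMap i (D.rootEquiv i r) = D.rootEquiv (i + 1) (D.frob r) := by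
  rw [rootEquiv_apply, rootMap_toRoot, rootEquiv_apply,
    ← D.toRoot_frob_pow (i + 1) (Fin.last i).castSucc (Fin.last (i + 1)) (Fin.le_last _)]
  simp

theorem toRoot_zero_eq (i : ℕ) (r : R) :
    D.toRoot i 0 r = D.rootEquiv i ((D.frob ^ i) r) := by
  rw [rootEquiv_apply, ← D.toRoot_frob_pow i 0 (Fin.last i) (Fin.zero_le _)]
  simp

/-- The canonical map from the `j`-th term to `R_perf`. -/
def toPerf (j : ℕ) : R →+* D.Perf :=
  Ring.DirectLimit.of (fun _ : ℕ => R) (fun j k _ => ⇑(D.frob ^ (k - j) : R →+* R)) j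

theorem toPerf_frob_pow {j k : ℕ} (h : j ≤ k) (r : R) :
    D.toPerf k ((D.frob ^ (k - j)) r) = D.toPerf j r :=
  Ring.DirectLimit.of_f (G := fun _ : ℕ => R)
    (f := fun j k _ => ⇑(D.frob ^ (k - j) : R →+* R)) h r

theorem toPerf_frob (j : ℕ) (r : R) : D.toPerf (j + 1) (D.frob r) = D.toPerf j r := by
  rw [← D.toPerf_frob_pow (Nat.le_succ j)]
  simp

theorem exists_toPerf (z : D.Perf) : ∃ j r, D.toPerf j r = z :=
  Ring.DirectLimit.exists_of z

/-- If φ(a) = 0 then a^p = -p δ(a), so a = p b because R/pR is reduced, and φ(b) = 0 because R is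
p-torsion-free. Repeating this, a is divisible by every power of p. -/
theorem frob_injective (htf : IsPTorsionFree p R) (hred : IsReduced (R ⧸ Ideal.span {(p : R)}))
    (hsep : IsHausdorff (Ideal.span {(p : R)}) R) : Function.Injective D.frob := by
  rw [injective_iff_map_eq_zero]
  have key : ∀ n a, D.frob a = 0 → (p : R) ^ n ∣ a := by
    intro n
    induction n with
    | zero => intro a _; rw [pow_zero]; exact one_dvd _
    | succ n ih =>
      intro a ha
      have h1 : (Ideal.Quotient.mk (Ideal.span {(p : R)}) a) ^ p = 0 := by
        rw [← map_pow, Ideal.Quotient.eq_zero_iff_mem, Ideal.mem_span_singleton]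
        rw [frob_apply, add_eq_zero_iff_eq_neg, ← mul_neg] at ha
        exact ⟨_, ha⟩
      have h2 := pow_eq_zero_iff hp.out.ne_zero |>.1 h1
      rw [Ideal.Quotient.eq_zero_iff_mem, Ideal.mem_span_singleton] at h2
      obtain ⟨b, rfl⟩ := h2
      rw [pow_succ']
      refine mul_dvd_mul_left _ (ih b (htf _ ?_))
      rwa [map_mul, map_natCast] at ha
  intro a ha
  refine hsep.haus a fun n => ?_
  rw [SModEq.zero, smul_eq_mul, Ideal.mul_top, Ideal.span_singleton_pow, Ideal.mem_span_singleton]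
  exact key n a ha

end DeltaStructure

/-- An integer q prime to p is a unit in A: from s p + t q = 1, the product t q is 1 modulo the
Jacobson radical. So p-torsion-free implies torsion-free, which over ℤ is flat. -/
theorem flat_int_of_isZariskian {p : ℕ} [hp : Fact p.Prime] {A : Type u} [CommRing A]
    (htf : IsPTorsionFree p A) (hzar : IsZariskian (Ideal.span {(p : A)})) :
    Module.Flat ℤ A := by
  have key : ∀ (m : ℕ) (a : A), m ≠ 0 → (m : A) * a = 0 → a = 0 := by
    intro m a hm ha
    obtain ⟨e, q, hq, rfl⟩ := Nat.exists_eq_pow_mul_and_not_dvd hm p hp.out.ne_one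
    have hu : IsUnit (q : A) := by
      have hcop : IsCoprime ((p : ℕ) : ℤ) (q : ℤ) :=
        Nat.isCoprime_iff_coprime.2 ((Nat.Prime.coprime_iff_not_dvd hp.out).2 hq)
      obtain ⟨s, t, hst⟩ := hcop
      have h1 := congrArg (Int.cast : ℤ → A) hst
      push_cast at h1
      have h2 : (t : A) * q = p * (-s) + 1 := by rw [← h1]; ring
      have h3 : IsUnit ((t : A) * q) := by
        rw [h2]
        exact Ideal.mem_jacobson_bot.1 (hzar (Ideal.mem_span_singleton_self _)) _
      exact isUnit_of_mul_isUnit_right h3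
    have h1 : (p : A) ^ e * a = 0 := by
      rw [← hu.mul_right_eq_zero, ← ha]
      push_cast
      ring
    clear ha
    induction e with
    | zero => simpa using h1
    | succ e ih =>
      exact ih (Nat.mul_ne_zero (pow_ne_zero _ hp.out.ne_zero) (by rintro rfl; simp at hq))
        (htf _ (by rw [← h1]; ring))
  have hT : Module.IsTorsionFree ℤ A := Module.IsTorsionFree.of_smul_eq_zero fun m a h => by
    rcases eq_or_ne m 0 with hm | hm
    · exact Or.inl hm
    · refine Or.inr (key m.natAbs a (Int.natAbs_ne_zero.2 hm) ?_)
      rw [zsmul_eq_mul] at h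
      rcases Int.natAbs_eq m with h1 | h1
      · rw [h1, Int.cast_natCast] at h
        exact h
      · rw [h1, Int.cast_neg, Int.cast_natCast, neg_mul, neg_eq_zero] at h
        exact h
  rw [Module.Flat.flat_iff_torsion_eq_bot_of_isBezout, ← Submodule.isTorsionFree_iff_torsion_eq_bot]
  exact hT

end

/-! ### The towers R^{1/p^i} ⊗ ℤ[x_i] and their reductions modulo p -/

noncomputable section

open Polynomial RingTower

theorem RingTower.extIdeal_span_natCast {p : ℕ} (T : RingTower.{u}) {S : Type v} [CommRing S]
    (e : S ≃+* T.obj 0) (i : ℕ) :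
    T.extIdeal e (Ideal.span {(p : S)}) i = Ideal.span {(p : T.obj i)} := by
  rw [extIdeal, Ideal.map_span, Set.image_singleton, map_natCast]

theorem RingTower.trans_self (T : RingTower.{u}) (i : ℕ) : T.trans i i le_rfl = RingHom.id _ :=
  Nat.leRec_self _ _

theorem RingTower.redMap_mk (T : RingTower.{u}) {S : Type v} [CommRing S]
    (e : S ≃+* T.obj 0) (I0 : Ideal S) (i : ℕ) (z : T.obj i) :
    T.redMap e I0 i (Ideal.Quotient.mk _ z) = Ideal.Quotient.mk _ (T.map i z) := rfl

theorem IsPTorsionFree.tensor {p : ℕ} {A : Type u} [CommRing A] (hA : IsPTorsionFree p A)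
    {M : Type*} [CommRing M] [Module.Flat ℤ M] : IsPTorsionFree p (A ⊗[ℤ] M) := by
  intro z hz
  have h1 : Function.Injective (LinearMap.mulLeft ℤ (p : A)) :=
    (injective_iff_map_eq_zero _).2 fun a ha => hA a ha
  have h2 := Module.Flat.rTensor_preserves_injective_linearMap (M := M) _ h1
  refine h2 (Eq.trans ?_ (map_zero _).symm)
  rw [← hz]
  clear hz
  have h3 : (p : A ⊗[ℤ] M) = (p : A) ⊗ₜ 1 :=
    (map_natCast (Algebra.TensorProduct.includeLeftRingHom : A →+* A ⊗[ℤ] M) p).symm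
  induction z using TensorProduct.induction_on with
  | zero => rw [map_zero, mul_zero]
  | add a b ha hb => rw [map_add, ha, hb, mul_add]
  | tmul a b =>
    rw [h3, Algebra.TensorProduct.tmul_mul_tmul, one_mul]
    rfl

namespace AdjoinTower

variable {p : ℕ} [hp : Fact p.Prime] {R : Type u} [CommRing R] (D : DeltaStructure p R)
  {x : ℕ → QBar} (hx : ∀ i, x (i + 1) ^ p = x i)

/-- The map `R^{1/p^i} → R^{1/p^i} ⊗ ℤ[x i]`. -/
def left (i : ℕ) : D.Root i →+* (adjoinTower D x hx).obj i :=
  (Algebra.TensorProduct.includeLeftRingHom : D.Root i →+* D.Root i ⊗[ℤ] ZAdjoin (x i))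

/-- The map `ℤ[x i] → R^{1/p^i} ⊗ ℤ[x i]`. -/
def right (i : ℕ) : ZAdjoin (x i) →+* (adjoinTower D x hx).obj i :=
  (Algebra.TensorProduct.includeRight : ZAdjoin (x i) →ₐ[ℤ] D.Root i ⊗[ℤ] ZAdjoin (x i)).toRingHom

theorem map_left (i : ℕ) (r : D.Root i) :
    (adjoinTower D x hx).map i (left D hx i r) = left D hx (i + 1) (D.rootMap i r) := by
  change (D.rootMap i r ⊗ₜ[ℤ] Subalgebra.inclusion (ZAdjoin_le hx i) 1 :
        D.Root (i + 1) ⊗[ℤ] ZAdjoin (x (i + 1))) = D.rootMap i r ⊗ₜ[ℤ] 1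
  rw [map_one]

theorem map_right (i : ℕ) (z : ZAdjoin (x i)) :
    (adjoinTower D x hx).map i (right D hx i z) =
      right D hx (i + 1) (Subalgebra.inclusion (ZAdjoin_le hx i) z) := by
  change (D.rootMap i 1 ⊗ₜ[ℤ] Subalgebra.inclusion (ZAdjoin_le hx i) z :
        D.Root (i + 1) ⊗[ℤ] ZAdjoin (x (i + 1))) = 1 ⊗ₜ[ℤ] _
  rw [map_one]

/-- The evaluation map `R[X] → R^{1/p^i} ⊗ ℤ[x i]` at `x i - c`, where `R` is identified with
`R^{1/p^i}`. -/
def eval (c : ℤ) (i : ℕ) : R[X] →+* (adjoinTower D x hx).obj i :=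
  eval₂RingHom ((left D hx i).comp (D.rootEquiv i)) (right D hx i (ZAdjoin.gen (x i) c))

theorem eval_eq (c : ℤ) (i : ℕ) (f : R[X]) :
    eval D hx c i f = tensorEval (D.Root i) (x i) c (f.map (D.rootEquiv i : R →+* D.Root i)) :=
  (eval₂_map (D.rootEquiv i : R →+* D.Root i) _ _).symm

theorem eval_surjective (c : ℤ) (i : ℕ) : Function.Surjective (eval D hx c i) := by
  intro z
  obtain ⟨f, rfl⟩ := tensorEval_surjective (D.Root i) (x i) c z
  obtain ⟨f, rfl⟩ := Polynomial.map_surjective _ (D.rootEquiv i).surjective f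
  exact ⟨f, eval_eq D hx c i f⟩

theorem eval_C (c : ℤ) (i : ℕ) (a : R) : eval D hx c i (C a) = left D hx i (D.rootEquiv i a) :=
  eval₂_C _ _

theorem eval_X (c : ℤ) (i : ℕ) : eval D hx c i X = right D hx i (ZAdjoin.gen (x i) c) :=
  eval₂_X _ _

theorem rootEquiv_natCast_dvd_iff (i : ℕ) (a : R) :
    (p : D.Root i) ∣ D.rootEquiv i a ↔ (p : R) ∣ a := by
  rw [← map_natCast (D.rootEquiv i) p]
  exact map_dvd_iff (D.rootEquiv i)

theorem root_zariskian (hzar : IsZariskian (Ideal.span {(p : R)})) (i : ℕ) :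
    IsZariskian (Ideal.span {(p : D.Root i)}) := by
  have h := Ideal.map_mono (f := (D.rootEquiv i : R →+* D.Root i)) hzar
  rw [Ideal.map_jacobson_of_bijective (f := (D.rootEquiv i : R →+* D.Root i))
    (D.rootEquiv i).bijective, Ideal.map_bot, Ideal.map_span, Set.image_singleton, map_natCast] at h
  exact h

theorem root_flat [Module.Flat ℤ R] (i : ℕ) : Module.Flat ℤ (D.Root i) :=
  Module.Flat.of_linearEquiv (D.rootEquiv i).symm.toAddEquiv.toIntLinearEquiv

section Uniformizer

variable {c : ℤ} {n : ℕ} {g : ℤ[X]} {i : ℕ} (hU : IsUniformizer p n (x i) c g)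

include hU

theorem natCast_dvd_eval_iff (f : R[X]) :
    (p : (adjoinTower D x hx).obj i) ∣ eval D hx c i f ↔
      X ^ n ∣ f.map (Ideal.Quotient.mk (Ideal.span {(p : R)})) := by
  rw [eval_eq]
  refine hU.natCast_dvd_tensorEval_iff.trans ?_
  simp only [X_pow_dvd_iff, coeff_map, Ideal.Quotient.eq_zero_iff_mem, Ideal.mem_span_singleton]
  exact forall₂_congr fun d _ => rootEquiv_natCast_dvd_iff D i _

theorem zariskian (hzar : IsZariskian (Ideal.span {(p : R)})) :
    IsZariskian (Ideal.span {(p : (adjoinTower D x hx).obj i)}) :=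
  hU.isZariskian_tensor (root_zariskian D hzar i)

theorem span_gen_pow_eq (hzar : IsZariskian (Ideal.span {(p : R)})) :
    Ideal.span {right D hx i (ZAdjoin.gen (x i) c) ^ n} =
      Ideal.span {(p : (adjoinTower D x hx).obj i)} :=
  hU.span_gen_pow_eq (hU.isZariskian_tensor (root_zariskian D hzar i))

theorem isPTorsionFree (htf : IsPTorsionFree p R) :
    IsPTorsionFree p ((adjoinTower D x hx).obj i) := by
  have h2 := hU.free
  refine IsPTorsionFree.tensor (A := D.Root i) (M := ZAdjoin (x i)) fun a ha => ?_
  obtain ⟨a, rfl⟩ := (D.rootEquiv i).surjective a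
  rw [← map_natCast (D.rootEquiv i), ← map_mul, map_eq_zero_iff _ (D.rootEquiv i).injective] at ha
  rw [htf a ha, map_zero]

/-- A tensor product of two injective maps; flatness of R^{1/p^{i+1}} and of ℤ[x_i] over ℤ keeps it
injective. -/
theorem map_injective [Module.Flat ℤ R] (hφ : Function.Injective D.frob) :
    Function.Injective ((adjoinTower D x hx).map i) := by
  have h1 := root_flat D (i + 1)
  have h2 := hU.free
  refine TensorProduct.map_injective_of_flat_flat (D.rootMap i).toIntAlgHom.toLinearMap
    (Subalgebra.inclusion (ZAdjoin_le hx i)).toLinearMap ?_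
    (Subalgebra.inclusion_injective (ZAdjoin_le hx i))
  intro a b hab
  obtain ⟨a, rfl⟩ := (D.rootEquiv i).surjective a
  obtain ⟨b, rfl⟩ := (D.rootEquiv i).surjective b
  have hab' : D.rootMap i (D.rootEquiv i a) = D.rootMap i (D.rootEquiv i b) := hab
  rw [D.rootMap_rootEquiv, D.rootMap_rootEquiv] at hab'
  rw [hφ ((D.rootEquiv (i + 1)).injective hab')]

end Uniformizer

variable {S : Type v} [CommRing S] (e : S ≃+* (adjoinTower D x hx).obj 0)

theorem natCast_red_eq_zero (i : ℕ) :
    ((p : ℕ) : (adjoinTower D x hx).Red e (Ideal.span {(p : S)}) i) = 0 := by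
  rw [← map_natCast (Ideal.Quotient.mk _), Ideal.Quotient.eq_zero_iff_mem, extIdeal_span_natCast]
  exact Ideal.mem_span_singleton_self _

theorem redMap_gen (c : ℤ) (i : ℕ) :
    (adjoinTower D x hx).redMap e (Ideal.span {(p : S)}) i
        (Ideal.Quotient.mk _ (right D hx i (ZAdjoin.gen (x i) c))) =
      (Ideal.Quotient.mk _ (right D hx (i + 1) (ZAdjoin.gen (x (i + 1)) c))) ^ p := by
  -- As a ring homomorphism the p-th power distributes over x_{i+1} - c and fixes the integer c.
  change _ = frobeniusOf p _ (natCast_red_eq_zero D hx e (i + 1)) _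
  rw [redMap_mk, map_right, ZAdjoin.gen, ZAdjoin.gen, map_sub, map_sub, map_sub, map_sub, map_sub,
    map_sub, map_intCast, map_intCast, map_intCast, map_intCast]
  congr 1
  change _ = (Ideal.Quotient.mk _ _) ^ p
  rw [← map_pow, ← map_pow]
  congr 2
  exact Subtype.ext (hx i).symm

/-- The evaluation map modulo `p`. -/
def redEval (c : ℤ) (i : ℕ) : (R ⧸ Ideal.span {(p : R)})[X] →+*
    (adjoinTower D x hx).Red e (Ideal.span {(p : S)}) i :=
  eval₂RingHom (Ideal.Quotient.lift _ ((Ideal.Quotient.mk _).comp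
      ((eval D hx c i).comp C)) fun a ha => by
    obtain ⟨b, rfl⟩ := Ideal.mem_span_singleton.1 ha
    rw [map_mul, map_natCast, natCast_red_eq_zero, zero_mul])
    (Ideal.Quotient.mk _ (eval D hx c i X))

theorem redEval_map (c : ℤ) (i : ℕ) (f : R[X]) :
    redEval D hx e c i (f.map (Ideal.Quotient.mk _)) = Ideal.Quotient.mk _ (eval D hx c i f) := by
  have : (redEval D hx e c i).comp (mapRingHom (Ideal.Quotient.mk _)) =
      (Ideal.Quotient.mk _).comp (eval D hx c i) := by
    refine Polynomial.ringHom_ext (fun a => ?_) ?_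
    · simp [redEval]
    · simp [redEval]
  exact RingHom.congr_fun this f

/-- Two ring homomorphisms on k[X] are compared on generators: on constants by φ(a) ≡ a^p, on X by
`redMap_gen`. -/
theorem redMap_redEval (c : ℤ) (i : ℕ) (f : (R ⧸ Ideal.span {(p : R)})[X]) :
    (adjoinTower D x hx).redMap e (Ideal.span {(p : S)}) i (redEval D hx e c i f) =
      redEval D hx e c (i + 1) f ^ p := by
  have : ((adjoinTower D x hx).redMap e (Ideal.span {(p : S)}) i).comp (redEval D hx e c i) =
      (frobeniusOf p _ (natCast_red_eq_zero D hx e (i + 1))).comp (redEval D hx e c (i + 1)) := by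
    refine Polynomial.ringHom_ext (fun a => ?_) ?_
    · obtain ⟨a, rfl⟩ := Ideal.Quotient.mk_surjective a
      rw [RingHom.comp_apply, RingHom.comp_apply, ← map_C, redEval_map, redEval_map, redMap_mk,
        eval_C, eval_C, map_left, D.rootMap_rootEquiv, D.frob_apply, map_add, map_mul, map_natCast,
        map_add, map_mul, map_natCast, map_add, map_mul, map_natCast, natCast_red_eq_zero, zero_mul,
        add_zero, map_pow, map_pow, map_pow]
      rfl
    · rw [RingHom.comp_apply, RingHom.comp_apply, ← map_X (Ideal.Quotient.mk _), redEval_map,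
        redEval_map, eval_X, eval_X, redMap_gen]
      rfl
  exact RingHom.congr_fun this f

variable {c : ℤ} {n₀ : ℕ} {g : ℕ → ℤ[X]} (hU : ∀ i, IsUniformizer p (p ^ i * n₀) (x i) c (g i))

/-- The truncated presentation of the tower. -/
def presentation : TruncatedPresentation p (R ⧸ Ideal.span {(p : R)}) (adjoinTower D x hx) e
    (Ideal.span {(p : S)}) where
  n i := p ^ i * n₀
  n_zero_pos := (hU 0).poly.pos
  n_succ i := by ring
  s i := redEval D hx e c i
  surj i z := by
    obtain ⟨z, rfl⟩ := Ideal.Quotient.mk_surjective z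
    obtain ⟨f, rfl⟩ := eval_surjective D hx c i z
    exact ⟨_, redEval_map D hx e c i f⟩
  ker i f := by
    obtain ⟨f, rfl⟩ := Polynomial.map_surjective _ Ideal.Quotient.mk_surjective f
    rw [redEval_map, Ideal.Quotient.eq_zero_iff_mem, extIdeal_span_natCast,
      Ideal.mem_span_singleton, natCast_dvd_eval_iff D hx (hU i)]
  redMap_s i f := redMap_redEval D hx e c i f

include hU in
theorem exists_isPerfectoidTower (htf : IsPTorsionFree p R)
    (hzar : IsZariskian (Ideal.span {(p : R)}))
    (hred : IsReduced (R ⧸ Ideal.span {(p : R)})) :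
    ∃ h : IsPerfectoidTower p (adjoinTower D x hx) e (Ideal.span {(p : S)}),
      Nonempty (TowerIso h.toIsPurelyInseparableTower.tilt (powerSeriesTower p R)) := by
  let P := presentation D hx e hU
  have h : IsPerfectoidTower p (adjoinTower D x hx) e (Ideal.span {(p : S)}) := by
    -- The generator of I_1 is ϖ = (x_1 - c)^{n_0}. Its p-th power has exponent p n_0 = n_1 and so
    -- generates (p).
    refine P.isPerfectoidTower rfl (fun i => isPTorsionFree D hx (hU i) htf)
      (fun i => zariskian D hx (hU i) hzar) (right D hx 1 (ZAdjoin.gen (x 1) c) ^ n₀) ?_ fun i => ?_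
    · rw [← pow_mul, mul_comm n₀, ← span_gen_pow_eq D hx (hU 1) hzar, pow_one]
    -- Modulo p, x_1 - c becomes (x_{i+1} - c)^{p^i}, so ϖ becomes X^{p^i n_0} = X^{n_i}.
    · have key : ∀ i, Ideal.Quotient.mk ((adjoinTower D x hx).extIdeal e (Ideal.span {(p : S)})
            (i + 1)) ((adjoinTower D x hx).trans 1 (i + 1) (Nat.le_add_left 1 i)
              (right D hx 1 (ZAdjoin.gen (x 1) c))) =
          (Ideal.Quotient.mk _ (right D hx (i + 1) (ZAdjoin.gen (x (i + 1)) c))) ^ p ^ i := by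
        intro i
        induction i with
        | zero => rw [trans_self, pow_zero, pow_one]; rfl
        | succ i ih =>
          rw [trans_succ _ (Nat.le_add_left 1 i), RingHom.comp_apply, ← redMap_mk, ih, map_pow,
            redMap_gen, ← pow_mul, pow_succ']
      rw [map_pow, map_pow, key, ← pow_mul]
      change _ = redEval D hx e c (i + 1) (X ^ (p ^ i * n₀))
      rw [← map_X (Ideal.Quotient.mk _), ← Polynomial.map_pow, redEval_map, map_pow, map_pow,
        eval_X]
  exact ⟨h, P.nonempty_tiltIso _ _⟩

end AdjoinTower
end

/-! ### The two systems of roots, and the colimits of the towers -/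

noncomputable section

open Polynomial RingTower

theorem IsCompatibleRoots.pow_eq {p : ℕ} {A : Type*} [CommRing A] {a : A} {x : ℕ → A}
    (h : IsCompatibleRoots p a x) (i : ℕ) : x i ^ p ^ i = a := by
  induction i with
  | zero => rw [pow_zero, pow_one, h.1]
  | succ i ih => rw [pow_succ', pow_mul, h.2, ih]

theorem IsCompatibleRoots.aeval_eq_zero {p : ℕ} {A : Type*} [CommRing A] {x : ℕ → A}
    (h : IsCompatibleRoots p (p : A) x) (i : ℕ) :
    aeval (x i - ((0 : ℤ) : A)) (X ^ (p ^ i * 1) - C (p : ℤ)) = 0 := by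
  simp [h.pow_eq]

theorem IsCompatibleRootsOfUnity.aeval_eq_zero {p : ℕ} [hp : Fact p.Prime] {A : Type*} [CommRing A]
    [IsDomain A] {x : ℕ → A} (h : IsCompatibleRootsOfUnity p x) (i : ℕ) :
    aeval (x (i + 1) - ((1 : ℤ) : A)) ((cyclotomic (p ^ (i + 1)) ℤ).comp (X + 1)) = 0 := by
  have h1 := (h.1 (i + 1)).isRoot_cyclotomic (pow_pos hp.out.pos _)
  rw [aeval_comp]
  rw [IsRoot.def, ← map_cyclotomic_int, eval_map, ← algebraMap_int_eq, ← aeval_def] at h1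
  simpa using h1

theorem IsCompatibleRoots.isUniformizer {p : ℕ} [hp : Fact p.Prime] {π : ℕ → QBar}
    (h : IsCompatibleRoots p (p : QBar) π) (i : ℕ) :
    IsUniformizer p (p ^ i * 1) (π i) 0 (X ^ (p ^ i * 1) - C (p : ℤ)) :=
  ⟨isUniformizerPoly_X_pow_sub p (Nat.mul_pos (pow_pos hp.out.pos i) one_pos), h.aeval_eq_zero i⟩

theorem IsCompatibleRootsOfUnity.isUniformizer {p : ℕ} [hp : Fact p.Prime] {ζ : ℕ → QBar}
    (h : IsCompatibleRootsOfUnity p ζ) (i : ℕ) :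
    IsUniformizer p (p ^ i * (p - 1)) (ζ (i + 1)) 1
      ((cyclotomic (p ^ (i + 1)) ℤ).comp (X + 1)) :=
  ⟨isUniformizerPoly_cyclotomic p i, h.aeval_eq_zero i⟩

theorem ZAdjoin_mono {p : ℕ} {x : ℕ → QBar} (hx : ∀ i, x (i + 1) ^ p = x i) :
    Monotone fun i => ZAdjoin (x i) :=
  monotone_nat_of_le_succ (ZAdjoin_le hx)

theorem ZAdjoin_le_all (x : ℕ → QBar) (i : ℕ) : ZAdjoin (x i) ≤ ZAdjoinAll x :=
  Algebra.adjoin_mono (Set.singleton_subset_iff.2 ⟨i, rfl⟩)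

theorem ZAdjoinAll_le_iSup (x : ℕ → QBar) : ZAdjoinAll x ≤ ⨆ i, ZAdjoin (x i) :=
  Algebra.adjoin_le <| by
    rintro _ ⟨i, rfl⟩
    exact le_iSup (fun i => ZAdjoin (x i)) i (Algebra.self_mem_adjoin_singleton ℤ (x i))

theorem exists_mem_ZAdjoin {p : ℕ} {x : ℕ → QBar} (hx : ∀ i, x (i + 1) ^ p = x i) {z : QBar}
    (hz : z ∈ ZAdjoinAll x) : ∃ i, z ∈ ZAdjoin (x i) := by
  have h := ZAdjoinAll_le_iSup x hz
  rw [← SetLike.mem_coe, Subalgebra.coe_iSup_of_directed (ZAdjoin_mono hx).directed_le,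
    Set.mem_iUnion] at h
  exact h

theorem tensorInt_ringHom_ext {A B C : Type*} [CommRing A] [CommRing B] [CommRing C]
    {f g : A ⊗[ℤ] B →+* C} (hl : ∀ a, f (a ⊗ₜ 1) = g (a ⊗ₜ 1))
    (hr : ∀ b, f (1 ⊗ₜ b) = g (1 ⊗ₜ b)) : f = g := by
  refine RingHom.ext fun z => ?_
  induction z using TensorProduct.induction_on with
  | zero => rw [map_zero, map_zero]
  | add a b ha hb => rw [map_add, map_add, ha, hb]
  | tmul a b =>
    have h : (a ⊗ₜ[ℤ] b : A ⊗[ℤ] B) = (a ⊗ₜ 1) * (1 ⊗ₜ b) := by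
      rw [Algebra.TensorProduct.tmul_mul_tmul, mul_one, one_mul]
    rw [h, map_mul, map_mul, hl, hr]

namespace DeltaStructure

variable {p : ℕ} [hp : Fact p.Prime] {R : Type u} [CommRing R] (D : DeltaStructure p R)

/-- The canonical map `R^{1/p^i} → R_perf`. -/
def rootToPerf (i : ℕ) : D.Root i →+* D.Perf :=
  (D.toPerf i).comp (D.rootEquiv i).symm.toRingHom

theorem rootToPerf_rootEquiv (i : ℕ) (r : R) : D.rootToPerf i (D.rootEquiv i r) = D.toPerf i r :=
  congrArg (D.toPerf i) ((D.rootEquiv i).symm_apply_apply r)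

theorem rootToPerf_rootMap (i : ℕ) (r : D.Root i) :
    D.rootToPerf (i + 1) (D.rootMap i r) = D.rootToPerf i r := by
  obtain ⟨r, rfl⟩ := (D.rootEquiv i).surjective r
  rw [rootMap_rootEquiv, rootToPerf_rootEquiv, rootToPerf_rootEquiv, toPerf_frob]

end DeltaStructure

namespace AdjoinTower

variable {p : ℕ} [hp : Fact p.Prime] {R : Type u} [CommRing R] (D : DeltaStructure p R)
  {x : ℕ → QBar} (hx : ∀ i, x (i + 1) ^ p = x i)

/-- The canonical map from a term of the tower to `R_perf ⊗ ℤ[x 0, x 1, …]`. -/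
def toPerfTensor (i : ℕ) : (adjoinTower D x hx).obj i →+* D.Perf ⊗[ℤ] ZAdjoinAll x :=
  (Algebra.TensorProduct.map (D.rootToPerf i).toIntAlgHom
    (Subalgebra.inclusion (ZAdjoin_le_all x i)) :
      D.Root i ⊗[ℤ] ZAdjoin (x i) →ₐ[ℤ] D.Perf ⊗[ℤ] ZAdjoinAll x).toRingHom

theorem toPerfTensor_left (i : ℕ) (r : D.Root i) :
    toPerfTensor D hx i (left D hx i r) = D.rootToPerf i r ⊗ₜ 1 := by
  change D.rootToPerf i r ⊗ₜ[ℤ] Subalgebra.inclusion (ZAdjoin_le_all x i) 1 = _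
  rw [map_one]

theorem toPerfTensor_right (i : ℕ) (z : ZAdjoin (x i)) :
    toPerfTensor D hx i (right D hx i z) = 1 ⊗ₜ Subalgebra.inclusion (ZAdjoin_le_all x i) z := by
  change D.rootToPerf i 1 ⊗ₜ[ℤ] _ = _
  rw [map_one]
  rfl

theorem ringHom_ext {i : ℕ} {B : Type*} [CommRing B] {f g : (adjoinTower D x hx).obj i →+* B}
    (hl : ∀ r, f (left D hx i r) = g (left D hx i r))
    (hr : ∀ z, f (right D hx i z) = g (right D hx i z)) : f = g :=   tensorInt_ringHom_ext (A := D.Root i) (B := ZAdjoin (x i)) hl hr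

theorem toPerfTensor_map (i : ℕ) (z : (adjoinTower D x hx).obj i) :
    toPerfTensor D hx (i + 1) ((adjoinTower D x hx).map i z) = toPerfTensor D hx i z := by
  have : (toPerfTensor D hx (i + 1)).comp ((adjoinTower D x hx).map i) = toPerfTensor D hx i := by
    refine ringHom_ext D hx (fun r => ?_) fun z => ?_
    · rw [RingHom.comp_apply, map_left, toPerfTensor_left, toPerfTensor_left, D.rootToPerf_rootMap]
    · rw [RingHom.comp_apply, map_right, toPerfTensor_right, toPerfTensor_right,
        Subalgebra.inclusion_inclusion]
  exact RingHom.congr_fun this z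

theorem toPerfTensor_trans {i j : ℕ} (h : i ≤ j) (z : (adjoinTower D x hx).obj i) :
    toPerfTensor D hx j ((adjoinTower D x hx).trans i j h z) = toPerfTensor D hx i z := by
  induction j, h using Nat.le_induction with
  | base => rw [trans_self]; rfl
  | succ j h ih => rw [trans_succ _ h, RingHom.comp_apply, toPerfTensor_map, ih]

theorem trans_left {i j : ℕ} (h : i ≤ j) (r : R) :
    (adjoinTower D x hx).trans i j h (left D hx i (D.rootEquiv i r)) =
      left D hx j (D.rootEquiv j ((D.frob ^ (j - i)) r)) := by
  induction j, h using Nat.le_induction with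
  | base => rw [trans_self, Nat.sub_self, pow_zero]; rfl
  | succ j h ih =>
    rw [trans_succ _ h, RingHom.comp_apply, ih, map_left, D.rootMap_rootEquiv, Nat.succ_sub h,
      pow_succ']
    rfl

theorem trans_right {i j : ℕ} (h : i ≤ j) (z : ZAdjoin (x i)) :
    (adjoinTower D x hx).trans i j h (right D hx i z) =
      right D hx j (Subalgebra.inclusion (ZAdjoin_mono hx h) z) := by
  induction j, h using Nat.le_induction with
  | base => rw [trans_self]; rfl
  | succ j h ih =>
    rw [trans_succ _ h, RingHom.comp_apply, ih, map_right, Subalgebra.inclusion_inclusion]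

/-- The canonical map to the colimit. -/
def ofColim (i : ℕ) : (adjoinTower D x hx).obj i →+* (adjoinTower D x hx).Colim :=
  Ring.DirectLimit.of (adjoinTower D x hx).obj (fun i j h => ⇑((adjoinTower D x hx).trans i j h)) i

theorem ofColim_trans {i j : ℕ} (h : i ≤ j) (z : (adjoinTower D x hx).obj i) :
    ofColim D hx j ((adjoinTower D x hx).trans i j h z) = ofColim D hx i z :=
  Ring.DirectLimit.of_f (G := (adjoinTower D x hx).obj)
    (f := fun i j h => ⇑((adjoinTower D x hx).trans i j h)) h z

/-- The map from the colimit of the tower to `R_perf ⊗ ℤ[x 0, x 1, …]`. -/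
def colimTo : (adjoinTower D x hx).Colim →+* D.Perf ⊗[ℤ] ZAdjoinAll x :=
  Ring.DirectLimit.lift _ _ _ (toPerfTensor D hx) fun _ _ h z => toPerfTensor_trans D hx h z

theorem colimTo_ofColim (i : ℕ) (z : (adjoinTower D x hx).obj i) :
    colimTo D hx (ofColim D hx i z) = toPerfTensor D hx i z :=
  Ring.DirectLimit.lift_of _ _ _ _ _

/-- The map from `R_perf` to the colimit of the tower. -/
def perfToColim : D.Perf →+* (adjoinTower D x hx).Colim :=
  Ring.DirectLimit.lift _ _ _ (fun j => (ofColim D hx j).comp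
    ((left D hx j).comp (D.rootEquiv j).toRingHom)) fun i j h r => by
      refine Eq.trans ?_ (ofColim_trans D hx h _)
      exact congrArg (ofColim D hx j) (trans_left D hx h r).symm

theorem perfToColim_toPerf (j : ℕ) (r : R) :
    perfToColim D hx (D.toPerf j r) = ofColim D hx j (left D hx j (D.rootEquiv j r)) :=
  Ring.DirectLimit.lift_of _ _ _ _ _

/-- Both elements agree at level `max i j`. This compatibility glues the maps from the ℤ[x_i] along
their directed union. -/
theorem ofColim_right_eq {i j : ℕ} (z : ZAdjoin (x i)) (hz : z.1 ∈ ZAdjoin (x j)) :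
    ofColim D hx i (right D hx i z) = ofColim D hx j (right D hx j ⟨z.1, hz⟩) := by
  rw [← ofColim_trans D hx (le_max_left i j), trans_right,
    ← ofColim_trans D hx (le_max_right i j), trans_right]
  rfl

/-- The map from `ℤ[x 0, x 1, …]` to the colimit of the tower. -/
def adjoinToColim : ZAdjoinAll x →ₐ[ℤ] (adjoinTower D x hx).Colim :=
  Subalgebra.iSupLift (fun i => ZAdjoin (x i)) (ZAdjoin_mono hx).directed_le
    (fun i => ((ofColim D hx i).comp (right D hx i)).toIntAlgHom)
    (fun _ _ h => AlgHom.ext fun z => ofColim_right_eq D hx z (h z.2)) _ (ZAdjoinAll_le_iSup x)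

theorem adjoinToColim_inclusion (i : ℕ) (z : ZAdjoin (x i)) :
    adjoinToColim D hx (Subalgebra.inclusion (ZAdjoin_le_all x i) z) =
      ofColim D hx i (right D hx i z) :=
  Subalgebra.iSupLift_inclusion _ _ _

/-- The map from `R_perf ⊗ ℤ[x 0, x 1, …]` to the colimit of the tower. -/
def toColim : D.Perf ⊗[ℤ] ZAdjoinAll x →ₐ[ℤ] (adjoinTower D x hx).Colim :=
  Algebra.TensorProduct.lift (perfToColim D hx).toIntAlgHom (adjoinToColim D hx)
    fun _ _ => Commute.all _ _

theorem toColim_left (a : D.Perf) : toColim D hx (a ⊗ₜ 1) = perfToColim D hx a := by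
  refine (Algebra.TensorProduct.lift_tmul _ _ _ _ _).trans ?_
  rw [map_one, mul_one]
  rfl

theorem toColim_right (z : ZAdjoinAll x) : toColim D hx (1 ⊗ₜ z) = adjoinToColim D hx z := by
  refine (Algebra.TensorProduct.lift_tmul _ _ _ _ _).trans ?_
  rw [map_one, one_mul]

/-- The colimit of the tower. -/
def colimEquiv : (adjoinTower D x hx).Colim ≃+* D.Perf ⊗[ℤ] ZAdjoinAll x :=
  RingEquiv.ofRingHom (colimTo D hx) (toColim D hx).toRingHom
    (by
      refine tensorInt_ringHom_ext (fun a => ?_) fun z => ?_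
      · change colimTo D hx (toColim D hx (a ⊗ₜ 1)) = a ⊗ₜ 1
        obtain ⟨j, r, rfl⟩ := D.exists_toPerf a
        rw [toColim_left, perfToColim_toPerf, colimTo_ofColim, toPerfTensor_left,
          D.rootToPerf_rootEquiv]
      · change colimTo D hx (toColim D hx (1 ⊗ₜ z)) = 1 ⊗ₜ z
        obtain ⟨i, hi⟩ := exists_mem_ZAdjoin hx z.2
        have hz : z = Subalgebra.inclusion (ZAdjoin_le_all x i) ⟨z.1, hi⟩ := rfl
        rw [hz, toColim_right, adjoinToColim_inclusion, colimTo_ofColim, toPerfTensor_right])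
    (by
      refine Ring.DirectLimit.hom_ext _ fun i => ?_
      refine ringHom_ext D hx (fun r => ?_) fun z => ?_
      · obtain ⟨r, rfl⟩ := (D.rootEquiv i).surjective r
        change toColim D hx (colimTo D hx (ofColim D hx i _)) = ofColim D hx i _
        rw [colimTo_ofColim, toPerfTensor_left, toColim_left, D.rootToPerf_rootEquiv,
          perfToColim_toPerf]
      · change toColim D hx (colimTo D hx (ofColim D hx i _)) = ofColim D hx i _
        rw [colimTo_ofColim, toPerfTensor_right, toColim_right, adjoinToColim_inclusion])

end AdjoinTower
end

/-! ### The towers as subrings of a domain -/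

noncomputable section

open Polynomial RingTower

theorem ZAdjoin_ringHom_ext {x : QBar} {B : Type*} [CommRing B] {f g : ZAdjoin x →+* B}
    (h : f ⟨x, Algebra.self_mem_adjoin_singleton ℤ x⟩ =
      g ⟨x, Algebra.self_mem_adjoin_singleton ℤ x⟩) : f = g := by
  have h1 : f.comp (aeval (R := ℤ) (ZAdjoin.gen x 0)).toRingHom =
      g.comp (aeval (R := ℤ) (ZAdjoin.gen x 0)).toRingHom := by
    refine Polynomial.ringHom_ext (fun a => by simp) ?_
    simpa [ZAdjoin.gen] using h
  ext z
  obtain ⟨q, rfl⟩ := ZAdjoin.aeval_gen_surjective x 0 z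
  exact RingHom.congr_fun h1 q

namespace IsUniformizer

variable {p : ℕ} [hp : Fact p.Prime] {n : ℕ} {x : QBar} {c : ℤ} {g : ℤ[X]}
  (hU : IsUniformizer p n x c g) {B : Type*} [CommRing B] {y : B} (hy : aeval (y - c) g = 0)

/-- The map `ℤ[x] → B` with `x ↦ y`. -/
def liftAdjoin : ZAdjoin x →ₐ[ℤ] B :=
  (AdjoinRoot.liftAlgHom g (Algebra.ofId ℤ B) (y - c) hy).comp hU.adjoinRootEquiv.symm.toAlgHom

theorem liftAdjoin_gen : hU.liftAdjoin hy (ZAdjoin.gen x c) = y - c := by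
  change AdjoinRoot.liftAlgHom g (Algebra.ofId ℤ B) (y - c) hy
    (hU.adjoinRootEquiv.symm (ZAdjoin.gen x c)) = y - c
  rw [← hU.adjoinRootEquiv_root, AlgEquiv.symm_apply_apply]
  exact AdjoinRoot.lift_root hy

theorem liftAdjoin_self :
    hU.liftAdjoin hy ⟨x, Algebra.self_mem_adjoin_singleton ℤ x⟩ = y := by
  have h := hU.liftAdjoin_gen hy
  rw [ZAdjoin.gen, map_sub, map_intCast] at h
  exact sub_left_injective h

end IsUniformizer

theorem isHausdorff_span_natCast_iff {p : ℕ} {A : Type*} [CommRing A] :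
    IsHausdorff (Ideal.span {(p : A)}) A ↔ ∀ a : A, (∀ m, (p : A) ^ m ∣ a) → a = 0 := by
  rw [isHausdorff_iff]
  simp only [SModEq.zero, smul_eq_mul, Ideal.mul_top, Ideal.span_singleton_pow,
    Ideal.mem_span_singleton]

namespace AdjoinTower

variable {p : ℕ} [hp : Fact p.Prime] {R : Type u} [CommRing R] (D : DeltaStructure p R)
  {x : ℕ → QBar} (hx : ∀ i, x (i + 1) ^ p = x i)

theorem eval_eq_zero_of_dvd {n : ℕ} {c : ℤ} {g : ℤ[X]} {i : ℕ} (hU : IsUniformizer p n (x i) c g)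
    {f : R[X]} (hf : g.map (Int.castRingHom R) ∣ f) : eval D hx c i f = 0 := by
  rw [eval_eq]
  refine hU.tensorEval_eq_zero_iff.2 ?_
  have h := map_dvd (mapRingHom (D.rootEquiv i : R →+* D.Root i)) hf
  rw [coe_mapRingHom, Polynomial.map_map] at h
  rwa [RingHom.ext_int (Int.castRingHom (D.Root i))
    ((D.rootEquiv i : R →+* D.Root i).comp (Int.castRingHom R))]

variable {c : ℤ} {n : ℕ → ℕ} {g : ℕ → ℤ[X]} (hU : ∀ i, IsUniformizer p (n i) (x i) c (g i))
  {B : Type v} [CommRing B] (ε : ∀ i, D.Root i →+* B) {y : ℕ → B}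
  (hy : ∀ i, aeval (y i - c) (g i) = 0)

/-- The canonical map `R^{1/p^i} ⊗ ℤ[x i] → B`. -/
def liftTo (i : ℕ) : (adjoinTower D x hx).obj i →+* B :=
  (Algebra.TensorProduct.lift (ε i).toIntAlgHom ((hU i).liftAdjoin (hy i))
    (fun _ _ => Commute.all _ _) : D.Root i ⊗[ℤ] ZAdjoin (x i) →ₐ[ℤ] B).toRingHom

theorem liftTo_left (i : ℕ) (r : D.Root i) : liftTo D hx hU ε hy i (left D hx i r) = ε i r := by
  refine (Algebra.TensorProduct.lift_tmul _ _ _ _ _).trans ?_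
  rw [map_one, mul_one]
  rfl

theorem liftTo_right (i : ℕ) (z : ZAdjoin (x i)) :
    liftTo D hx hU ε hy i (right D hx i z) = (hU i).liftAdjoin (hy i) z := by
  refine (Algebra.TensorProduct.lift_tmul _ _ _ _ _).trans ?_
  rw [map_one, one_mul]

theorem liftTo_eval (i : ℕ) (f : R[X]) : liftTo D hx hU ε hy i (eval D hx c i f) =
    f.eval₂ ((ε i).comp (D.rootEquiv i)) (y i - c) := by
  rw [eval, coe_eval₂RingHom, hom_eval₂, liftTo_right, (hU i).liftAdjoin_gen]
  congr 1
  exact RingHom.ext fun r => liftTo_left D hx hU ε hy i _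

/-- The kernel of R[X] → B is generated by g, by `IsUniformizerPoly.eval₂_eq_zero_iff`, and g
already vanishes in the i-th term. -/
theorem liftTo_injective [IsDomain B] (hsep : ∀ a : R, (∀ m, (p : R) ^ m ∣ a) → a = 0)
    (hpR : Prime (p : R)) (i : ℕ) (hε : Function.Injective (ε i)) :
    Function.Injective (liftTo D hx hU ε hy i) := by
  rw [injective_iff_map_eq_zero]
  intro z hz
  obtain ⟨f, rfl⟩ := eval_surjective D hx c i z
  refine eval_eq_zero_of_dvd D hx (hU i) ?_
  -- The Eisenstein criterion is stated for a target field, so pass to the fraction field of B.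
  obtain ⟨K, _, φ, hφ⟩ : ∃ (K : Type v) (_ : Field K) (φ : B →+* K), Function.Injective φ :=
    ⟨FractionRing B, inferInstance, algebraMap _ _, IsFractionRing.injective B (FractionRing B)⟩
  have hinj : Function.Injective (φ.comp ((ε i).comp (D.rootEquiv i : R →+* D.Root i))) :=
    hφ.comp (hε.comp (D.rootEquiv i).injective)
  have hroot : aeval (φ (y i - c)) (g i) = 0 := by
    have h := aeval_algHom_apply φ.toIntAlgHom (y i - c) (g i)
    rw [hy, map_zero] at h
    exact h
  refine ((hU i).poly.eval₂_eq_zero_iff hinj hpR hsep hroot).1 ?_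
  rw [← hom_eval₂, ← liftTo_eval D hx hU ε hy, hz, map_zero]

theorem range_liftTo (i : ℕ) : (liftTo D hx hU ε hy i).range = subringAdjoin D ε y i := by
  refine le_antisymm ?_ (Subring.closure_le.2 ?_)
  · rintro _ ⟨z, rfl⟩
    obtain ⟨f, rfl⟩ := eval_surjective D hx c i z
    rw [liftTo_eval]
    have hy' : y i - c ∈ subringAdjoin D ε y i :=
      sub_mem (Subring.subset_closure (Or.inr rfl)) (intCast_mem _ c)
    induction f using Polynomial.induction_on' with
    | add f f' hf hf' => rw [eval₂_add]; exact add_mem hf hf'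
    | monomial k a =>
      rw [eval₂_monomial]
      exact mul_mem (Subring.subset_closure (Or.inl ⟨_, rfl⟩)) (pow_mem hy' k)
  · rintro _ (⟨r, rfl⟩ | rfl)
    · exact ⟨left D hx i r, liftTo_left D hx hU ε hy i r⟩
    · exact ⟨right D hx i _, (liftTo_right D hx hU ε hy i _).trans ((hU i).liftAdjoin_self (hy i))⟩

theorem liftTo_map (hε : ∀ i r, ε (i + 1) (D.rootMap i r) = ε i r)
    (hyp : ∀ i, y (i + 1) ^ p = y i) (i : ℕ) (z : (adjoinTower D x hx).obj i) :
    liftTo D hx hU ε hy (i + 1) ((adjoinTower D x hx).map i z) = liftTo D hx hU ε hy i z := by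
  have : (liftTo D hx hU ε hy (i + 1)).comp ((adjoinTower D x hx).map i) =
      liftTo D hx hU ε hy i := by
    refine ringHom_ext D hx (fun r => ?_) fun z => ?_
    · rw [RingHom.comp_apply, map_left, liftTo_left, liftTo_left, hε]
    · rw [RingHom.comp_apply, map_right, liftTo_right, liftTo_right]
      have h : ((hU (i + 1)).liftAdjoin (hy (i + 1))).toRingHom.comp
          (Subalgebra.inclusion (ZAdjoin_le hx i)).toRingHom =
          ((hU i).liftAdjoin (hy i)).toRingHom := by
        refine ZAdjoin_ringHom_ext ?_
        have h1 : Subalgebra.inclusion (ZAdjoin_le hx i)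
            ⟨x i, Algebra.self_mem_adjoin_singleton ℤ (x i)⟩ =
            ⟨x (i + 1), Algebra.self_mem_adjoin_singleton ℤ (x (i + 1))⟩ ^ p :=
          Subtype.ext (hx i).symm
        change (hU (i + 1)).liftAdjoin (hy (i + 1)) (Subalgebra.inclusion (ZAdjoin_le hx i) _) =
          (hU i).liftAdjoin (hy i) _
        rw [h1, map_pow, IsUniformizer.liftAdjoin_self, IsUniformizer.liftAdjoin_self, hyp]
      exact RingHom.congr_fun h z
  exact RingHom.congr_fun this z

include hU hy in
theorem isSubringTower [IsDomain B] (hsep : ∀ a : R, (∀ m, (p : R) ^ m ∣ a) → a = 0)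
    (hpR : Prime (p : R)) (hεinj : ∀ i, Function.Injective (ε i))
    (hε : ∀ i r, ε (i + 1) (D.rootMap i r) = ε i r) (hyp : ∀ i, y (i + 1) ^ p = y i) :
    IsSubringTower D x hx ε y := by
  have hS : Monotone (subringAdjoin D ε y) := monotone_nat_of_le_succ fun i => by
    rw [← range_liftTo D hx hU ε hy, ← range_liftTo D hx hU ε hy]
    rintro _ ⟨z, rfl⟩
    exact ⟨_, liftTo_map D hx hU ε hy hε hyp i z⟩
  let E : ∀ i, (adjoinTower D x hx).obj i ≃+* subringAdjoin D ε y i := fun i =>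
    RingEquiv.ofBijective ((liftTo D hx hU ε hy i).codRestrict (subringAdjoin D ε y i)
      fun z => (range_liftTo D hx hU ε hy i).le ⟨z, rfl⟩)
      ⟨fun a b hab => liftTo_injective D hx hU ε hy hsep hpR i (hεinj i)
        (congrArg Subtype.val hab), fun z => by
          obtain ⟨w, hw⟩ := (range_liftTo D hx hU ε hy i).ge z.2
          exact ⟨w, Subtype.ext hw⟩⟩
  refine ⟨hS, ⟨E, fun i z => Subtype.ext (liftTo_map D hx hU ε hy hε hyp i z)⟩, fun i =>
    ⟨fun r => liftTo_left D hx hU ε hy i r, ?_⟩⟩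
  exact (liftTo_right D hx hU ε hy i _).trans ((hU i).liftAdjoin_self (hy i))

end AdjoinTower
end

/-! ### Embeddings and roots in the absolute integral closure -/

noncomputable section

open Polynomial RingTower

/-- An extension exists as B is integral over A and L is algebraically closed. Its kernel meets A in
0, and in an integral extension of domains a nonzero ideal has nonzero contraction. -/
theorem RingHom.IsIntegral.exists_extension {A : Type u} {B : Type v} {L : Type w} [CommRing A]
    [CommRing B] [IsDomain A] [IsDomain B] [Field L] [IsAlgClosed L] {φ : A →+* B}
    (hφ : Function.Injective φ) (hint : φ.IsIntegral) {e : A →+* L} (he : Function.Injective e) :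
    ∃ e' : B →+* L, e'.comp φ = e ∧ Function.Injective e' := by
  let _ := φ.toAlgebra
  let _ := e.toAlgebra
  have : FaithfulSMul A B := (faithfulSMul_iff_algebraMap_injective A B).2 hφ
  have : FaithfulSMul A L := (faithfulSMul_iff_algebraMap_injective A L).2 he
  have : Module.IsTorsionFree A B := inferInstance
  have : Module.IsTorsionFree A L := inferInstance
  have : Algebra.IsIntegral A B := ⟨hint⟩
  let e' : B →ₐ[A] L := IsAlgClosed.lift
  have h1 : e'.toRingHom.comp φ = e := RingHom.ext e'.commutes
  refine ⟨e'.toRingHom, h1, ?_⟩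
  rw [RingHom.injective_iff_ker_eq_bot]
  refine Ideal.eq_bot_of_comap_eq_bot (R := A) ?_
  change (RingHom.ker e'.toRingHom).comap φ = ⊥
  rw [RingHom.comap_ker, h1, ← RingHom.injective_iff_ker_eq_bot]
  exact he

theorem RingHom.IsIntegral.pow {A : Type u} [CommRing A] {φ : A →+* A} (h : φ.IsIntegral) (n : ℕ) :
    (φ ^ n).IsIntegral := by
  induction n with
  | zero => exact fun a => RingHom.isIntegralElem_map (RingHom.id A)
  | succ n ih => rw [pow_succ']; exact RingHom.IsIntegral.trans _ _ ih h

theorem IsIntegrallyClosedIn.exists_pow_eq (R : Type u) [CommRing R] (L : Type v) [Field L]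
    [IsAlgClosed L] [Algebra R L] {n : ℕ} (hn : 0 < n) (a : integralClosure R L) :
    ∃ b : integralClosure R L, b ^ n = a := by
  obtain ⟨b, hb⟩ := IsAlgClosed.exists_pow_nat_eq (a : L) hn
  exact ⟨⟨b, IsIntegral.of_pow hn (hb ▸ a.2)⟩, Subtype.ext hb⟩

theorem exists_isCompatibleRoots {p : ℕ} {A : Type u} [CommRing A]
    (h : ∀ a : A, ∃ b, b ^ p = a) (a : A) : ∃ x, IsCompatibleRoots p a x := by
  choose s hs using h
  exact ⟨fun i => Nat.rec a (fun _ b => s b) i, rfl, fun i => hs _⟩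

/-- Compatible p-power roots w_i of z have order p^{i+1}. The sequence must start at 1, so it
consists of the w_i^p, of order p^i. -/
theorem exists_isCompatibleRootsOfUnity {p : ℕ} [hp : Fact p.Prime] {A : Type u} [CommRing A]
    (h : ∀ a : A, ∃ b, b ^ p = a) {z : A} (hz : z ^ p = 1) (hz1 : z ≠ 1) :
    ∃ x : ℕ → A, IsCompatibleRootsOfUnity p x := by
  obtain ⟨w, hw⟩ := exists_isCompatibleRoots h z
  have hww : ∀ i, w i ^ p ^ i = z := hw.pow_eq
  have hsucc : ∀ i, w (i + 1) ^ p = w i := hw.2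
  have key : ∀ i, IsPrimitiveRoot (w i) (p ^ (i + 1)) := fun i => by
    rw [IsPrimitiveRoot.iff_orderOf]
    refine orderOf_eq_prime_pow ?_ ?_
    · rw [hww]; exact hz1
    · rw [pow_succ, pow_mul, hww, hz]
  refine ⟨fun i => w i ^ p, fun i => ?_, fun i => congrArg (· ^ p) (hsucc i)⟩
  exact (key i).pow (pow_pos hp.out.pos _) (pow_succ' p i)

namespace DeltaStructure

variable {p : ℕ} [hp : Fact p.Prime] {R : Type u} [CommRing R] (D : DeltaStructure p R)

theorem exists_isCompatibleEmbedding [IsDomain R] (hφ : Function.Injective D.frob)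
    (hint : D.frob.IsIntegral) (L : Type v) [Field L] [IsAlgClosed L] [Algebra R L]
    (hL : Function.Injective (algebraMap R L)) :
    ∃ ε : ∀ i, D.Root i →+* integralClosure R L, IsCompatibleEmbedding D ε := by
  choose F hF hFinj using fun e : {e : R →+* L // Function.Injective e} =>
    hint.exists_extension hφ e.2
  -- Starting from the structure map, each e_{i+1} extends e_i along φ, that is e_{i+1} ∘ φ = e_i.
  -- On last terms this is compatibility with the transition maps.
  let e : ℕ → {e : R →+* L // Function.Injective e} := fun i =>
    Nat.rec ⟨algebraMap R L, hL⟩ (fun _ e => ⟨F e, hFinj e⟩) i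
  have he : ∀ i, (e (i + 1)).1.comp D.frob = (e i).1 := fun i => hF (e i)
  have hpow : ∀ i, (e i).1.comp (D.frob ^ i) = algebraMap R L := by
    intro i
    induction i with
    | zero => rfl
    | succ i ih =>
      rw [pow_succ', RingHom.mul_def, ← RingHom.comp_assoc, he, ih]
  -- An integral equation of r over R along φ^i is carried by e_i to one over the structure map,
  -- since e_i ∘ φ^i is that map.
  have hmem : ∀ i r, (e i).1 r ∈ integralClosure R L := fun i r => by
    change (algebraMap R L).IsIntegralElem _
    rw [← hpow i]
    obtain ⟨q, hq, hq0⟩ := hint.pow i r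
    refine ⟨q, hq, ?_⟩
    rw [← hom_eval₂, hq0, map_zero]
  let ε : ∀ i, D.Root i →+* integralClosure R L := fun i =>
    ((e i).1.codRestrict _ (hmem i)).comp (D.rootEquiv i).symm.toRingHom
  have hε : ∀ i r, (ε i (D.rootEquiv i r) : L) = (e i).1 r := fun i r =>
    congrArg (e i).1 ((D.rootEquiv i).symm_apply_apply r)
  refine ⟨ε, fun i a b hab => ?_, fun i r => ?_, fun i r => ?_⟩
  · obtain ⟨a, rfl⟩ := (D.rootEquiv i).surjective a
    obtain ⟨b, rfl⟩ := (D.rootEquiv i).surjective b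
    have h := congrArg Subtype.val hab
    rw [hε, hε] at h
    rw [(e i).2 h]
  · refine Subtype.ext ?_
    rw [D.toRoot_zero_eq, hε]
    exact RingHom.congr_fun (hpow i) r
  · obtain ⟨r, rfl⟩ := (D.rootEquiv i).surjective r
    refine Subtype.ext ?_
    rw [D.rootMap_rootEquiv]
    exact (hε (i + 1) _).trans ((RingHom.congr_fun (he i) r).trans (hε i r).symm)

end DeltaStructure

theorem integralClosure_exists_isCompatibleRootsOfUnity {p : ℕ} [hp : Fact p.Prime] (R : Type u)
    [CommRing R] (L : Type v) [Field L] [IsAlgClosed L] [Algebra R L] (hpL : (p : L) ≠ 0) :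
    ∃ x : ℕ → integralClosure R L, IsCompatibleRootsOfUnity p x := by
  have : NeZero (p : L) := ⟨hpL⟩
  obtain ⟨z, hz⟩ := IsAlgClosed.exists_root (cyclotomic p L)
    (degree_cyclotomic_pos p L hp.out.pos).ne'
  rw [isRoot_cyclotomic_iff] at hz
  refine exists_isCompatibleRootsOfUnity (IsIntegrallyClosedIn.exists_pow_eq R L hp.out.pos)
    (z := ⟨z, IsIntegral.of_pow hp.out.pos (by rw [hz.pow_eq_one]; exact isIntegral_one)⟩)
    (Subtype.ext hz.pow_eq_one) fun h => ?_
  exact hz.ne_one hp.out.one_lt (congrArg Subtype.val h)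
end

/-! ### Comparison of ℤ[ζ_{p^∞}] with ℤ_p[ζ_{p^∞}] -/

noncomputable section

open Polynomial

theorem exists_tensor_lift {A P N C : Type*} [CommRing A] [CommRing P] [CommRing N] [CommRing C]
    [Algebra A P] [Algebra A N] (f : P →+* C) (h : N →+* C)
    (hc : ∀ a, h (algebraMap A N a) = f (algebraMap A P a)) :
    ∃ H : P ⊗[A] N →+* C, (∀ a, H (a ⊗ₜ 1) = f a) ∧ ∀ b, H (1 ⊗ₜ b) = h b := by
  let _ : Algebra A C := (f.comp (algebraMap A P)).toAlgebra
  let H : P ⊗[A] N →ₐ[A] C := Algebra.TensorProduct.lift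
    (AlgHom.mk f fun _ => rfl) (AlgHom.mk h hc) fun _ _ => Commute.all _ _
  refine ⟨H.toRingHom, fun a => ?_, fun b => ?_⟩
  · refine (Algebra.TensorProduct.lift_tmul _ _ _ _ _).trans ?_
    rw [map_one, mul_one]; rfl
  · refine (Algebra.TensorProduct.lift_tmul _ _ _ _ _).trans ?_
    rw [map_one, one_mul]; rfl

/-- If `M → N` is an isomorphism modulo all powers of `p` and `ℤ` is `p`-adically dense in `A`, then
`P ⊗_ℤ M → P ⊗_A N` is an isomorphism modulo all powers of `p`. -/
theorem IsIsoModPPow.tensor {p : ℕ} {A : Type*} {P : Type u} {M : Type v} {N : Type*}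
    [CommRing A] [CommRing P] [CommRing M] [CommRing N] [Algebra A P] [Algebra A N]
    {g : M →+* N} (hg : IsIsoModPPow p g)
    (hA : ∀ k (a : A), ∃ m : ℤ, (p : A) ^ k ∣ a - m) :
    ∃ G : P ⊗[ℤ] M →+* P ⊗[A] N, IsIsoModPPow p G := by
  obtain ⟨G, hGl, hGr⟩ : ∃ G : P ⊗[ℤ] M →+* P ⊗[A] N, (∀ a, G (a ⊗ₜ 1) = a ⊗ₜ 1) ∧
      ∀ m, G (1 ⊗ₜ m) = 1 ⊗ₜ g m :=
    exists_tensor_lift (Algebra.TensorProduct.includeLeftRingHom : P →+* P ⊗[A] N)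
      ((Algebra.TensorProduct.includeRight : N →ₐ[A] P ⊗[A] N).toRingHom.comp g)
      fun a => by rw [eq_intCast, eq_intCast, map_intCast, map_intCast]
  have hG : ∀ (a : P) (m : M), G (a ⊗ₜ m) = a ⊗ₜ g m := fun a m => by
    have h : (a ⊗ₜ[ℤ] m : P ⊗[ℤ] M) = (a ⊗ₜ 1) * (1 ⊗ₜ m) := by
      rw [Algebra.TensorProduct.tmul_mul_tmul, mul_one, one_mul]
    rw [h, map_mul, hGl, hGr, Algebra.TensorProduct.tmul_mul_tmul, mul_one, one_mul]
  refine ⟨G, fun k => ⟨fun z hz => ?_, fun b => ?_⟩⟩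
  -- Injectivity modulo p^k: with C = (P ⊗_ℤ M)/p^k, the quotient map q is shown to factor through
  -- G.
  · obtain ⟨C, _, q, hq⟩ : ∃ (C : Type (max u v)) (_ : CommRing C) (q : P ⊗[ℤ] M →+* C),
        ∀ z, q z = 0 ↔ (p : P ⊗[ℤ] M) ^ k ∣ z :=
      ⟨(P ⊗[ℤ] M) ⧸ Ideal.span {(p : P ⊗[ℤ] M) ^ k}, inferInstance, Ideal.Quotient.mk _,
        fun z => Ideal.Quotient.eq_zero_iff_mem.trans Ideal.mem_span_singleton⟩
    have hpC : (p : C) ^ k = 0 := by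
      rw [← map_natCast q, ← map_pow, hq]
    let fM : M →+* C := q.comp (Algebra.TensorProduct.includeRight : M →ₐ[ℤ] P ⊗[ℤ] M).toRingHom
    let fM' : M ⧸ Ideal.span {(p : M)} ^ k →+* C := Ideal.Quotient.lift _ fM <| by
      intro a ha
      rw [Ideal.span_singleton_pow, Ideal.mem_span_singleton] at ha
      obtain ⟨b, rfl⟩ := ha
      rw [map_mul, map_pow, map_natCast, hpC, zero_mul]
    -- N maps to C through N/p^k ≃ M/p^k.
    let h : N →+* C := (fM'.comp (hg.quotEquiv k).symm.toRingHom).comp (Ideal.Quotient.mk _)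
    have hh : ∀ m, h (g m) = fM m := fun m => by
      have h1 : (hg.quotEquiv k).symm (Ideal.Quotient.mk _ (g m)) = Ideal.Quotient.mk _ m := by
        rw [RingEquiv.symm_apply_eq]; rfl
      exact (congrArg fM' h1).trans (Ideal.Quotient.lift_mk _ _ _)
    let fP : P →+* C := q.comp (Algebra.TensorProduct.includeLeftRingHom : P →+* P ⊗[ℤ] M)
    -- The maps from N and P to C agree on A: modulo p^k every a is an integer m, and p^k = 0 in C.
    -- Hence any A-algebra structure on P will do.
    have hcomm : ∀ a : A, h (algebraMap A N a) = fP (algebraMap A P a) := fun a => by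
      obtain ⟨m, d, hd⟩ := hA k a
      have ha : a = m + (p : A) ^ k * d := by rw [← hd]; ring
      rw [ha]
      simp only [map_add, map_mul, map_pow, map_natCast, map_intCast, hpC, zero_mul]
    obtain ⟨H, hHl, hHr⟩ := exists_tensor_lift fP h hcomm
    have hHG : H.comp G = q := by
      refine tensorInt_ringHom_ext (fun a => ?_) fun m => ?_
      · rw [RingHom.comp_apply, hGl, hHl]; rfl
      · rw [RingHom.comp_apply, hGr, hHr, hh]; rfl
    have h2 := RingHom.congr_fun hHG z
    obtain ⟨w, hw⟩ := hz
    rw [RingHom.comp_apply, hw, map_mul, map_pow, map_natCast, hpC, zero_mul] at h2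
    exact (hq z).1 h2.symm
  · induction b using TensorProduct.induction_on with
    | zero => exact ⟨0, by rw [map_zero, sub_zero]; exact dvd_zero _⟩
    | add b b' hb hb' =>
      obtain ⟨a, ha⟩ := hb
      obtain ⟨a', ha'⟩ := hb'
      refine ⟨a + a', ?_⟩
      have := dvd_add ha ha'
      rwa [← add_sub_add_comm, ← map_add] at this
    | tmul a n =>
      obtain ⟨m, n', hn'⟩ := (hg k).2 n
      refine ⟨a ⊗ₜ m, a ⊗ₜ n', ?_⟩
      have h1 : (p : P ⊗[A] N) ^ k = 1 ⊗ₜ ((p : N) ^ k) := by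
        have := map_natCast (Algebra.TensorProduct.includeRight : N →ₐ[A] P ⊗[A] N) (p ^ k)
        push_cast at this
        exact this.symm
      rw [hG, ← TensorProduct.tmul_sub, hn', h1, Algebra.TensorProduct.tmul_mul_tmul, one_mul]

theorem PadicInt.eq_zero_of_forall_pow_dvd {p : ℕ} [Fact p.Prime] {a : ℤ_[p]}
    (h : ∀ m, (p : ℤ_[p]) ^ m ∣ a) : a = 0 := by
  by_contra h0
  exact (FiniteMultiplicity.of_not_isUnit PadicInt.prime_p.not_isUnit h0).not_pow_dvd_of_multiplicity_lt
    (Nat.lt_succ_self _) (h _)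

theorem PadicInt.exists_int_pow_dvd_sub {p : ℕ} [Fact p.Prime] (k : ℕ) (a : ℤ_[p]) :
    ∃ m : ℤ, (p : ℤ_[p]) ^ k ∣ a - m :=
  ⟨(a.appr k : ℕ), by
    have := PadicInt.appr_spec k a
    rwa [Ideal.mem_span_singleton] at this⟩

/-- The remainders of F and p^k B modulo g have equal values at y and degree below n, so they
coincide over ℤ_p. Divisibility of an integer by p^k in ℤ_p descends to ℤ. -/
theorem IsUniformizerPoly.C_dvd_modByMonic {p : ℕ} [hp : Fact p.Prime] {n : ℕ} {g : ℤ[X]}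
    (hg : IsUniformizerPoly p n g) {K : Type*} [Field K] {ε : ℤ_[p] →+* K}
    (hε : Function.Injective ε) {y : K} (hy : aeval y g = 0) {k : ℕ} {F : ℤ[X]} {B : ℤ_[p][X]}
    (h : aeval y F = (p : K) ^ k * B.eval₂ ε y) : C ((p : ℤ) ^ k) ∣ F %ₘ g := by
  have hgm : (g.map (Int.castRingHom ℤ_[p])).Monic := hg.monic.map _
  have hmap : ∀ F : ℤ[X], (F.map (Int.castRingHom ℤ_[p])).eval₂ ε y = aeval y F := fun F => by
    rw [eval₂_map, aeval_def]
    exact congrArg (fun φ => eval₂ φ y F) (RingHom.ext_int _ _)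
  have hF : (F %ₘ g).map (Int.castRingHom ℤ_[p]) =
      F.map (Int.castRingHom ℤ_[p]) %ₘ g.map (Int.castRingHom ℤ_[p]) := map_modByMonic _ hg.monic
  set B₀ := B %ₘ g.map (Int.castRingHom ℤ_[p]) with hB₀
  have hgy : (g.map (Int.castRingHom ℤ_[p])).eval₂ ε y = 0 := (hmap g).trans hy
  have hdeg : ∀ f : ℤ_[p][X], ∀ j, n ≤ j →
      (f %ₘ g.map (Int.castRingHom ℤ_[p])).coeff j = 0 := fun f j hj => by
    refine coeff_eq_zero_of_degree_lt ((degree_modByMonic_lt f hgm).trans_le ?_)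
    rw [degree_eq_natDegree hgm.ne_zero, hg.monic.natDegree_map, hg.natDegree_eq]
    exact_mod_cast hj
  have hmod : ∀ f : ℤ_[p][X], (f %ₘ g.map (Int.castRingHom ℤ_[p])).eval₂ ε y = f.eval₂ ε y :=
    fun f => by rw [modByMonic_eq_sub_mul_div, eval₂_sub, eval₂_mul, hgy, zero_mul, sub_zero]
  have h0 : (F %ₘ g).map (Int.castRingHom ℤ_[p]) - C ((p : ℤ_[p]) ^ k) * B₀ = 0 := by
    refine hg.eq_zero_of_eval₂_eq_zero hε PadicInt.prime_p
      (fun a => PadicInt.eq_zero_of_forall_pow_dvd) hy ?_ fun j hj => ?_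
    · rw [eval₂_sub, eval₂_mul, eval₂_C, hF, hmod, hmod, hmap, h, map_pow, map_natCast, sub_self]
    · rw [coeff_sub, coeff_C_mul, hF, hdeg _ j hj, hdeg _ j hj, mul_zero, sub_zero]
  rw [C_dvd_iff_dvd_coeff]
  intro j
  have h1 := congrArg (coeff · j) h0
  simp only [coeff_sub, coeff_map, coeff_C_mul, coeff_zero, sub_eq_zero] at h1
  exact (PadicInt.pow_p_dvd_int_iff k _).1 ⟨_, h1⟩

section Cyclotomic

variable {p : ℕ} [hp : Fact p.Prime]

omit hp in
theorem IsCompatibleRootsOfUnity.pow_pow {A : Type*} [CommRing A] {x : ℕ → A}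
    (h : IsCompatibleRootsOfUnity p x) (i j : ℕ) : x (i + j) ^ p ^ j = x i := by
  induction j with
  | zero => rw [pow_zero, pow_one]; rfl
  | succ j ih => rw [pow_succ', pow_mul, ← add_assoc, h.2, ih]

/-- The claim covers all large j so that two elements, or an element and one from ℤ[ζ_{p^∞}], can be
written at a common level. -/
theorem exists_aeval_eq_of_mem_ZpCyc {z : ℕ → AlgebraicClosure ℚ_[p]}
    (hz : IsCompatibleRootsOfUnity p z) {b : AlgebraicClosure ℚ_[p]} (hb : b ∈ ZpCyc p) :
    ∃ j₀, ∀ j, j₀ ≤ j → ∃ B : ℤ_[p][X], aeval (z (j + 1) - ((1 : ℤ) : AlgebraicClosure ℚ_[p])) B = b := by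
  induction hb using Algebra.adjoin_induction with
  | mem b hb =>
    obtain ⟨n, hn⟩ := hb
    obtain ⟨e, -, rfl⟩ := (hz.1 n).eq_pow_of_pow_eq_one hn
    refine ⟨n, fun j hj => ⟨(X + 1) ^ (p ^ (j + 1 - n) * e), ?_⟩⟩
    obtain ⟨m, hm⟩ := Nat.exists_eq_add_of_le (hj.trans (Nat.le_succ j))
    rw [Nat.succ_eq_add_one] at hm
    rw [hm, Nat.add_sub_cancel_left, pow_mul]
    simp [hz.pow_pow]
  | algebraMap r => exact ⟨0, fun j _ => ⟨C r, aeval_C _ _⟩⟩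
  | add b b' _ _ hb hb' =>
    obtain ⟨j₁, h1⟩ := hb
    obtain ⟨j₂, h2⟩ := hb'
    refine ⟨max j₁ j₂, fun j hj => ?_⟩
    obtain ⟨B, rfl⟩ := h1 j ((le_max_left _ _).trans hj)
    obtain ⟨B', rfl⟩ := h2 j ((le_max_right _ _).trans hj)
    exact ⟨B + B', map_add _ _ _⟩
  | mul b b' _ _ hb hb' =>
    obtain ⟨j₁, h1⟩ := hb
    obtain ⟨j₂, h2⟩ := hb'
    refine ⟨max j₁ j₂, fun j hj => ?_⟩
    obtain ⟨B, rfl⟩ := h1 j ((le_max_left _ _).trans hj)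
    obtain ⟨B', rfl⟩ := h2 j ((le_max_right _ _).trans hj)
    exact ⟨B * B', map_mul _ _ _⟩

theorem algebraMap_padicInt_injective :
    Function.Injective (algebraMap ℤ_[p] (AlgebraicClosure ℚ_[p])) := by
  rw [IsScalarTower.algebraMap_eq ℤ_[p] ℚ_[p] (AlgebraicClosure ℚ_[p])]
  exact (algebraMap ℚ_[p] (AlgebraicClosure ℚ_[p])).injective.comp
    (IsFractionRing.injective ℤ_[p] ℚ_[p])

theorem AlgebraicClosure.nonempty_ringHom (k : Type u) [Field k] (K : Type v) [Field K]
    [IsAlgClosed K] [Algebra k K] : Nonempty (AlgebraicClosure k →+* K) :=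
  ⟨(IsAlgClosed.lift : AlgebraicClosure k →ₐ[k] K).toRingHom⟩

omit hp in
theorem ZAdjoinAll_succ_eq {ζ : ℕ → QBar} (hζ : IsCompatibleRootsOfUnity p ζ) :
    ZAdjoinAll (fun i => ζ (i + 1)) = ZAdjoinAll ζ := by
  refine le_antisymm (Algebra.adjoin_mono ?_) (Algebra.adjoin_le ?_)
  · rintro _ ⟨i, rfl⟩
    exact ⟨i + 1, rfl⟩
  · rintro _ ⟨i, rfl⟩
    rw [← hζ.2 i]
    exact pow_mem (Algebra.subset_adjoin (Set.mem_range_self (f := fun i => ζ (i + 1)) i)) p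

/-- An embedding of `QBar` into the algebraic closure of ℚ_p induces the map. Injectivity modulo p^k
is `C_dvd_modByMonic` at a finite level; surjectivity holds as the p-power roots of unity are hit
and ℤ is dense in ℤ_p. -/
theorem exists_isIsoModPPow_ZpCyc {ζ : ℕ → QBar} (hζ : IsCompatibleRootsOfUnity p ζ) :
    ∃ g : ZAdjoinAll ζ →+* ZpCyc p, IsIsoModPPow p g := by
  obtain ⟨ι⟩ := AlgebraicClosure.nonempty_ringHom ℚ (AlgebraicClosure ℚ_[p])
  have hz : IsCompatibleRootsOfUnity p fun i => ι (ζ i) :=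
    ⟨fun i => (hζ.1 i).map_of_injective ι.injective, fun i => by rw [← map_pow, hζ.2]⟩
  have hmem : ∀ a : ZAdjoinAll ζ, ι a ∈ ZpCyc p := by
    have h1 : ZAdjoinAll ζ ≤ ((ZpCyc p).restrictScalars ℤ).comap ι.toIntAlgHom := by
      refine Algebra.adjoin_le ?_
      rintro _ ⟨i, rfl⟩
      exact Algebra.subset_adjoin ⟨i, (hz.1 i).pow_eq_one⟩
    exact fun a => h1 a.2
  let g : ZAdjoinAll ζ →+* ZpCyc p := (ι.comp (ZAdjoinAll ζ).val.toRingHom).codRestrict _ hmem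
  have hg : ∀ a, (g a : AlgebraicClosure ℚ_[p]) = ι a := fun _ => rfl
  refine ⟨g, fun k => ⟨fun a ha => ?_, fun b => ?_⟩⟩
  · obtain ⟨b, hb⟩ := ha
    obtain ⟨j₀, hj₀⟩ := exists_aeval_eq_of_mem_ZpCyc hz b.2
    obtain ⟨i₀, hi₀⟩ := exists_mem_ZAdjoin (x := fun i => ζ (i + 1)) (p := p) (z := a.1)
      (fun i => hζ.2 (i + 1)) (by rw [ZAdjoinAll_succ_eq hζ]; exact a.2)
    obtain ⟨i, hi, hi'⟩ : ∃ i, j₀ ≤ i ∧ i₀ ≤ i := ⟨max j₀ i₀, le_max_left _ _, le_max_right _ _⟩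
    obtain ⟨B, hB⟩ := hj₀ i hi
    obtain ⟨F, hF⟩ := ZAdjoin.aeval_gen_surjective (ζ (i + 1)) 1
      ⟨a.1, ZAdjoin_mono (x := fun i => ζ (i + 1)) (fun i => hζ.2 (i + 1)) hi' hi₀⟩
    have hU := hζ.isUniformizer i
    have hGz := hz.aeval_eq_zero i
    generalize (cyclotomic (p ^ (i + 1)) ℤ).comp (X + 1) = G at hU hGz
    have hF2 : aeval (ι (ζ (i + 1)) - ((1 : ℤ) : AlgebraicClosure ℚ_[p])) F =
        (p : AlgebraicClosure ℚ_[p]) ^ k *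
          B.eval₂ (algebraMap ℤ_[p] _) (ι (ζ (i + 1)) - ((1 : ℤ) : AlgebraicClosure ℚ_[p])) := by
      have h1 := congrArg Subtype.val hb
      have h2 := congrArg (fun z => ι z.1) hF
      have h3 := aeval_algHom_apply (ι.toIntAlgHom.comp (ZAdjoin (ζ (i + 1))).val)
        (ZAdjoin.gen (ζ (i + 1)) 1) F
      have h4 : (ι.toIntAlgHom.comp (ZAdjoin (ζ (i + 1))).val) (ZAdjoin.gen (ζ (i + 1)) 1) =
          ι (ζ (i + 1)) - ((1 : ℤ) : AlgebraicClosure ℚ_[p]) := by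
        rw [ZAdjoin.gen, map_sub, map_intCast]
        rfl
      rw [h4] at h3
      refine h3.trans (h2.trans ((hg a).symm.trans (h1.trans ?_)))
      rw [← aeval_def, hB]
      simp
    obtain ⟨F', hF'⟩ := hU.poly.C_dvd_modByMonic algebraMap_padicInt_injective
      hGz hF2
    have hG0 := hU.aeval_gen_self
    have h5 : aeval (ZAdjoin.gen (ζ (i + 1)) 1) F =
        (p : ZAdjoin (ζ (i + 1))) ^ k * aeval (ZAdjoin.gen (ζ (i + 1)) 1) F' := by
      rw [← aeval_modByMonic_eq_self_of_root hG0, hF', map_mul, aeval_C, map_pow, map_natCast]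
    refine ⟨Subalgebra.inclusion (ZAdjoin_le_all ζ (i + 1))
      (aeval (ZAdjoin.gen (ζ (i + 1)) 1) F'), Subtype.ext ?_⟩
    have h6 := congrArg Subtype.val (hF.symm.trans h5)
    refine h6.trans ?_
    simp
  · let φ := (Ideal.Quotient.mk (Ideal.span {(p : ZpCyc p) ^ k})).comp g
    -- The image modulo p^k is a subring, so only generators need checking.
    have key : Ideal.Quotient.mk (Ideal.span {(p : ZpCyc p) ^ k}) b ∈ φ.range := by
      obtain ⟨b, hb⟩ := b
      induction hb using Algebra.adjoin_induction with
      | mem b hb =>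
        obtain ⟨n, hn⟩ := hb
        obtain ⟨e, -, rfl⟩ := (hz.1 n).eq_pow_of_pow_eq_one hn
        refine ⟨⟨ζ n, Algebra.subset_adjoin ⟨n, rfl⟩⟩ ^ e, ?_⟩
        refine congrArg (Ideal.Quotient.mk _) (Subtype.ext ?_)
        rw [hg, SubmonoidClass.coe_pow, map_pow]
      | algebraMap r =>
        obtain ⟨m, d, hd⟩ := PadicInt.exists_int_pow_dvd_sub k r
        refine ⟨(m : ZAdjoinAll ζ), ?_⟩
        rw [map_intCast]
        have h1 : (algebraMap ℤ_[p] (ZpCyc p) r) = m + p ^ k * algebraMap ℤ_[p] (ZpCyc p) d := by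
          rw [← map_natCast (algebraMap ℤ_[p] (ZpCyc p)), ← map_pow, ← map_mul, ← hd,
            ← map_intCast (algebraMap ℤ_[p] (ZpCyc p)), ← map_add, add_sub_cancel]
        refine Eq.trans ?_ (congrArg (Ideal.Quotient.mk _) h1).symm
        rw [map_add, map_mul, Ideal.Quotient.eq_zero_iff_mem.2 (Ideal.mem_span_singleton_self _),
          zero_mul, add_zero, map_intCast]
      | add b b' hb hb' h h' => exact add_mem h h'
      | mul b b' hb hb' h h' => exact mul_mem h h'
    obtain ⟨a, ha⟩ := key
    exact ⟨a, Ideal.mem_span_singleton.1 (Ideal.Quotient.eq.1 ha)⟩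

end Cyclotomic
end

/-! ### Zeroth terms and assembly -/

section

variable {p : ℕ} [hp : Fact p.Prime] {R : Type u} [CommRing R]

/-- The zeroth term `R^{1/p^0} ⊗ ℤ[x 0]` of the tower is `R ⊗ ℤ[x 0]`. -/
noncomputable def AdjoinTower.zeroEquiv (D : DeltaStructure p R) {x : ℕ → QBar}
    (hx : ∀ i, x (i + 1) ^ p = x i) : R ⊗[ℤ] ZAdjoin (x 0) ≃+* (adjoinTower D x hx).obj 0 :=
  (Algebra.TensorProduct.congr
    (AlgEquiv.ofRingEquiv (f := D.rootEquiv 0) fun m => by simp : R ≃ₐ[ℤ] D.Root 0)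
    (AlgEquiv.refl : ZAdjoin (x 0) ≃ₐ[ℤ] ZAdjoin (x 0))).toRingEquiv

theorem ZAdjoin_natCast_eq_bot (n : ℕ) : ZAdjoin (n : QBar) = ⊥ :=
  le_antisymm (Algebra.adjoin_le (Set.singleton_subset_iff.2 (natCast_mem _ n))) bot_le

/-- The ring `A` is identified with `A ⊗ ℤ[n]` for an integer `n`. -/
noncomputable def tensorZAdjoinNatCastEquiv (A : Type*) [CommRing A] {x : QBar} {n : ℕ} (h : x = n) :
    A ≃+* A ⊗[ℤ] ZAdjoin x :=
  ((Algebra.TensorProduct.rid ℤ ℤ A).symm.trans (Algebra.TensorProduct.congr AlgEquiv.refl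
    ((Algebra.botEquivOfInjective (algebraMap ℤ QBar).injective_int).symm.trans
      (Subalgebra.equivOfEq _ _ (by rw [h, ZAdjoin_natCast_eq_bot]))))).toRingEquiv

theorem prime_natCast_of_isDomain_quotient {p : ℕ} {R : Type u} [CommRing R] [Nontrivial R]
    (htf : IsPTorsionFree p R) (h : IsDomain (R ⧸ Ideal.span {(p : R)})) : Prime (p : R) := by
  refine (Ideal.span_singleton_prime fun h0 => ?_).1 ((Ideal.Quotient.isDomain_iff_prime _).1 h)
  exact one_ne_zero (htf 1 (by rw [h0, zero_mul]))

/-- The isomorphism `A ⊗_ℤ M ≃ A ⊗_ℤ N` induced by an isomorphism `M ≃ N`. -/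
noncomputable def tensorIntCongrRight (A : Type u) {M : Type v} {N : Type w} [CommRing A]
    [CommRing M] [CommRing N] (e : M ≃+* N) : A ⊗[ℤ] M ≃+* A ⊗[ℤ] N :=
  (Algebra.TensorProduct.congr (AlgEquiv.refl : A ≃ₐ[ℤ] A)
    (AlgEquiv.ofRingEquiv (f := e) fun m => by simp)).toRingEquiv

/-- Level i of the tower uses ζ_{p^{i+1}}; omitting ζ_1 = 1 does not change the ring generated by
the whole sequence. -/
theorem exists_isIsoModPPow_colim_cyclotomicTower (D : DeltaStructure p R) {ζ : ℕ → QBar}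
    (hζ : IsCompatibleRootsOfUnity p ζ) :
    ∃ f : (cyclotomicTower D hζ).Colim →+* D.Perf ⊗[ℤ] ZAdjoinAll ζ, IsIsoModPPow p f :=
  ⟨_, (IsIsoModPPow.ofEquiv p (tensorIntCongrRight D.Perf
    (Subalgebra.equivOfEq _ _ (ZAdjoinAll_succ_eq hζ)).toRingEquiv)).comp
      (IsIsoModPPow.ofEquiv p (AdjoinTower.colimEquiv D (fun i => hζ.2 (i + 1))))⟩

theorem nonempty_completion_cyclotomicTower_equiv (D : DeltaStructure p R) {ζ : ℕ → QBar}
    (hζ : IsCompatibleRootsOfUnity p ζ) {A : Type*} [CommRing A] [Algebra A D.Perf]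
    [Algebra A (ZpCyc p)] (hA : ∀ k (a : A), ∃ m : ℤ, (p : A) ^ k ∣ a - m) :
    Nonempty (PCompletion p (cyclotomicTower D hζ).Colim ≃+*
      PCompletion p (D.Perf ⊗[A] ZpCyc p)) := by
  obtain ⟨f, hf⟩ := exists_isIsoModPPow_colim_cyclotomicTower D hζ
  obtain ⟨g, hg⟩ := exists_isIsoModPPow_ZpCyc hζ
  obtain ⟨G, hG⟩ := hg.tensor (P := D.Perf) hA
  exact ⟨(hG.comp hf).completionEquiv⟩

end

theorem mainTheorem2 (p : ℕ) [Fact p.Prime] {R : Type u} [CommRing R] (D : DeltaStructure p R)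
    (htf : IsPTorsionFree p R) (hzar : IsZariskian (Ideal.span {(p : R)}))
    (hred : IsReduced (R ⧸ Ideal.span {(p : R)}))
    (π : ℕ → QBar) (hπ : IsCompatibleRoots p (p : QBar) π)
    (ζ : ℕ → QBar) (hζ : IsCompatibleRootsOfUnity p ζ) :
    -- the first tower is a perfectoid tower arising from `(R, (p))`, with the stated tilt
    (∃ (e : R ≃+* (pRootTower D hπ).obj 0) (h : IsPerfectoidTower p (pRootTower D hπ) e (Ideal.span {(p : R)})),
      Nonempty (TowerIso h.toIsPurelyInseparableTower.tilt (powerSeriesTower p R))) ∧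
    -- the second tower is a perfectoid tower arising from `(R ⊗ ℤ[ζ_p], (p))`, same tilt
    (∃ (e : R ⊗[ℤ] ZAdjoin (ζ 1) ≃+* (cyclotomicTower D hζ).obj 0)
        (h : IsPerfectoidTower p (cyclotomicTower D hζ) e (Ideal.span {(p : R ⊗[ℤ] ZAdjoin (ζ 1))})),
      Nonempty (TowerIso h.toIsPurelyInseparableTower.tilt (powerSeriesTower p R))) ∧
    -- their terms are `p`-torsion-free
    (∀ i, IsPTorsionFree p ((pRootTower D hπ).obj i) ∧ IsPTorsionFree p ((cyclotomicTower D hζ).obj i)) ∧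
    -- injectivity of the transition maps
    (IsHausdorff (Ideal.span {(p : R)}) R →
      ∀ i, Function.Injective ((pRootTower D hπ).map i) ∧ Function.Injective ((cyclotomicTower D hζ).map i)) ∧
    -- the `p`-completed colimits
    Nonempty (PCompletion p (pRootTower D hπ).Colim ≃+* PCompletion p (D.Perf ⊗[ℤ] ZAdjoinAll π)) ∧
    Nonempty (PCompletion p (cyclotomicTower D hζ).Colim ≃+* PCompletion p (D.Perf ⊗[ℤ] ZAdjoinAll ζ)) ∧
    Nonempty (PCompletion p (cyclotomicTower D hζ).Colim ≃+* PCompletion p (D.Perf ⊗[ℤ] ZpCyc p)) ∧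
    (∀ [Algebra ℤ_[p] D.Perf],
      Nonempty (PCompletion p (cyclotomicTower D hζ).Colim ≃+* PCompletion p (D.Perf ⊗[ℤ_[p]] ZpCyc p))) ∧
    -- description by subrings of the absolute integral closure `integralClosure R L` of `R`
    (IsHausdorff (Ideal.span {(p : R)}) R → IsDomain R →
      IsDomain (R ⧸ Ideal.span {(p : R)}) → D.frob.Finite →
      ∀ (L : Type v) [Field L] [Algebra R L] [Module.IsTorsionFree R L] [IsAlgClosure R L],
        (∃ ε : ∀ i, D.Root i →+* integralClosure R L, IsCompatibleEmbedding D ε) ∧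
        (∃ π' : ℕ → integralClosure R L, IsCompatibleRoots p (p : integralClosure R L) π') ∧
        (∃ ζ' : ℕ → integralClosure R L, IsCompatibleRootsOfUnity p ζ') ∧
        ∀ ε : ∀ i, D.Root i →+* integralClosure R L, IsCompatibleEmbedding D ε →
          (∀ π' : ℕ → integralClosure R L, IsCompatibleRoots p (p : integralClosure R L) π' →
            IsSubringTower D π hπ.2 ε π') ∧
          (∀ ζ' : ℕ → integralClosure R L, IsCompatibleRootsOfUnity p ζ' →
            IsSubringTower D (fun i => ζ (i + 1)) (fun i => hζ.2 (i + 1)) ε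
              (fun i => ζ' (i + 1)))) := by

  have hflat : Module.Flat ℤ R := flat_int_of_isZariskian htf hzar
  refine ⟨AdjoinTower.exists_isPerfectoidTower D _
      -- Since π 0 = p is an integer, ℤ[π 0] = ℤ and the zeroth term is R itself.
      ((tensorZAdjoinNatCastEquiv R hπ.1).trans (AdjoinTower.zeroEquiv D hπ.2)) hπ.isUniformizer
      htf hzar hred |> fun h => ⟨_, h⟩,
    AdjoinTower.exists_isPerfectoidTower D _ (AdjoinTower.zeroEquiv D (fun i => hζ.2 (i + 1)))
      hζ.isUniformizer htf hzar hred |> fun h => ⟨_, h⟩,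
    fun i => ⟨AdjoinTower.isPTorsionFree D _ (hπ.isUniformizer i) htf,
      AdjoinTower.isPTorsionFree D _ (hζ.isUniformizer i) htf⟩,
    fun hsep i => ⟨AdjoinTower.map_injective D _ (hπ.isUniformizer i)
        (D.frob_injective htf hred hsep),
      AdjoinTower.map_injective D _ (hζ.isUniformizer i) (D.frob_injective htf hred hsep)⟩,
    ⟨(IsIsoModPPow.ofEquiv p (AdjoinTower.colimEquiv D hπ.2)).completionEquiv⟩, ?_,
    -- The same comparison with A = ℤ, where density is trivial, and then with A = ℤ_p.
    nonempty_completion_cyclotomicTower_equiv D hζ fun _ a => ⟨a, by simp⟩,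
    nonempty_completion_cyclotomicTower_equiv D hζ PadicInt.exists_int_pow_dvd_sub, ?_⟩
  · obtain ⟨f, hf⟩ := exists_isIsoModPPow_colim_cyclotomicTower D hζ
    exact ⟨hf.completionEquiv⟩
  · intro hsep _ hdom hfin L _ _ _ _
    have hacl : IsAlgClosed L := IsAlgClosure.isAlgClosed R
    have hpR := prime_natCast_of_isDomain_quotient htf hdom
    have hL : Function.Injective (algebraMap R L) := FaithfulSMul.algebraMap_injective R L
    have hpL : (p : L) ≠ 0 := by
      rw [← map_natCast (algebraMap R L)]
      exact (map_ne_zero_iff _ hL).2 hpR.ne_zero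
    have hsep' := isHausdorff_span_natCast_iff.1 hsep
    refine ⟨D.exists_isCompatibleEmbedding (D.frob_injective htf hred hsep) hfin.to_isIntegral L hL,
      exists_isCompatibleRoots
        (IsIntegrallyClosedIn.exists_pow_eq R L (Fact.out : p.Prime).pos) _,
      integralClosure_exists_isCompatibleRootsOfUnity R L hpL, fun ε hε => ⟨fun π' hπ' => ?_,
        fun ζ' hζ' => ?_⟩⟩
    · exact AdjoinTower.isSubringTower D hπ.2 hπ.isUniformizer ε hπ'.aeval_eq_zero hsep' hpR
        hε.injective hε.comm hπ'.2
    · exact AdjoinTower.isSubringTower D (fun i => hζ.2 (i + 1)) hζ.isUniformizer ε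
        hζ'.aeval_eq_zero hsep' hpR hε.injective hε.comm fun i => hζ'.2 (i + 1)
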